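/- Setting. Let $Q=-u^2-v^2+x_1^2+x_2^2$ on $\mathbb R^{2,2}$, let $SO_0(2,2)$ be the neutral component of $O(2,2)$, and $\mathrm{AdS}=\{Q=-1\}$ with the induced Lorentzian metric. Let $\mathbb D^2$ be the open upper hemisphere of the round sphere $\mathbb S^2\subset\mathbb R^3$ (third coordinate positive), $\mathbb S^1=\partial\mathbb D^2$ the equator, and $d$ the spherical distance. The universal covering $\widetilde{\mathrm{AdS}}$ is $\mathbb D^2\times\mathbb R$, with metric conformal to $ds^2-dt^2$, and its conformal boundary is the cyclic cover $\widehat{\mathrm{Ein}}_2=\mathbb S^1\times\mathbb R$ of the Einstein universe $\mathrm{Ein}_2$, with the conformal class of $ds^2-dt^2$; time is oriented by increasing $t$. The map $(x,t)\mapsto[\cos t:\sin t:x_1:x_2]$ (where $x_1,x_2$ are the first two coordinates of $x$) to rays of $\mathbb R^{2,2}$ sends $\widetilde{\mathrm{AdS}}$ onto the rays in $\{Q<0\}$ and $\widehat{\mathrm{Ein}}_2$ onto the rays in $\{Q=0\}$. The group $\widehat{SO}_0(2,2)$ of orientation and time-orientation preserving isometries of $\widetilde{\mathrm{AdS}}$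 is the group of all homeomorphisms of $\overline{\mathbb D}{}^2\times\mathbb R=\widetilde{\mathrm{AdS}}\cup\widehat{\mathrm{Ein}}_2$ that lift the action on rays of an element of $SO_0(2,2)$, with the compact-open topology. A subset $\widetilde\Lambda\subset\widehat{\mathrm{Ein}}_2$ is achronal if no timelike curve of $\widehat{\mathrm{Ein}}_2$ joins two of its points. The past (resp. future) lightcone of $(x,\theta)\in\widehat{\mathrm{Ein}}_2$ is the set of $(y,s)\in\widehat{\mathrm{Ein}}_2$ with $\theta-s=d(x,y)$ (resp. $s-\theta=d(x,y)$). The set $\widetilde\Lambda$ is generic unless it contains two opposite points $p=(-x,\theta+\pi)$ and $q=(x,\theta)$ and is contained in the past lightcone of $p$ and in the future lightcone of $q$. It is nonelementary if it is contained neither in the past lightcone nor in the future lightcone of any point of $\widehat{\mathrm{Ein}}_2$. For $\widetilde\Lambda$ closed, nonempty and achronal, hence the graph of a $1$-Lipschitz function $f:\Lambda_0\to\mathbb R$ with $\Lambda_0\subset\mathbb S^1$ closed, put $f_-(x)=\sup_{y\in\Lambda_0}(f(y)-d(x,y))$ and $f_+(x)=\inf_{y\in\Lambda_0}(f(y)+d(x,y))$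 for $x\in\overline{\mathbb D}{}^2$; the invisible domains are $$E(\widetilde\Lambda)=\{(x,t)\in\mathbb D^2\times\mathbb R: f_-(x)<t<f_+(x)\},\qquad \Omega(\widetilde\Lambda)=\{(x,t)\in\mathbb S^1\times\mathbb R: f_-(x)<t<f_+(x)\}.$$ Theorem. Let $\widetilde\Lambda\subset\widehat{\mathrm{Ein}}_2$ be a closed, achronal, generic and nonelementary subset, and let $\Gamma\subset\widehat{SO}_0(2,2)$ be a discrete torsion-free subgroup preserving $\widetilde\Lambda$. Then $\Gamma$ preserves $\Omega(\widetilde\Lambda)$ and $E(\widetilde\Lambda)$, and acts on each of them freely and properly discontinuously (every compact subset meets only finitely many of its translates). Moreover the quotient spacetime $M_{\widetilde\Lambda}(\Gamma)=\Gamma\backslash E(\widetilde\Lambda)$ is strongly causal: its manifold topology coincides with its Alexandrov topology, generated by the sets $U(a,b)$, for $b$ in the future of $a$, where $U(a,b)$ is the intersection of the future of $a$ and the past of $b$, futures and pasts being taken with respect to timelike curves of $M_{\widetilde\Lambda}(\Gamma)$. -/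

import Mathlib

open Set Filter Topology

noncomputable section

namespace AdSCausal

/-- Euclidean three-space, containing the unit sphere `𝕊²`. -/
abbrev E3 : Type := EuclideanSpace ℝ (Fin 3)

/-- The closed upper hemisphere of `𝕊²`, that is `{x : ‖x‖ = 1, 0 ≤ x₂}` (coordinates are
`x 0`, `x 1`, `x 2`).  Its interior is the open disc `𝔻²`, its boundary is the equator `𝕊¹`. -/
abbrev Hemisphere : Type := {x : E3 // ‖x‖ = 1 ∧ 0 ≤ x 2}

/-- The conformal completion of the universal anti-de Sitter space together with its boundary,
as the part of the cyclic cover `𝕊² × ℝ` of the three-dimensional Einstein universe that lies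
over the closed upper hemisphere. -/
abbrev Cyl : Type := Hemisphere × ℝ

/-- The cyclic cover `𝕊¹ × ℝ` of the two-dimensional Einstein universe, the conformal boundary
of the universal anti-de Sitter space. -/
def einHat : Set Cyl := {p | p.1.1 2 = 0}

/-- The universal anti-de Sitter space `𝔻² × ℝ`.  Its metric is `(ds² - dt²) / x₂²`, which is the
pullback of the metric of `{Q = -1}` under
`(x, t) ↦ (cos t, sin t, x₀, x₁) / x₂`, where `Q = -u² - v² + x₁² + x₂²`. -/
def adsTilde : Set Cyl := {p | 0 < p.1.1 2}

/-- The spherical distance of `𝕊²` on the closed hemisphere; on the equator it is the arc length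
distance of the circle. -/
def sphDist (x y : Hemisphere) : ℝ := InnerProductGeometry.angle x.1 y.1

/-! ### Causality -/

/-- The quadratic form `ds² - dt²` on tangent vectors `(v, τ)`.  It represents the conformal
Lorentzian structures of `𝕊² × ℝ`, of its subset `adsTilde` and of `einHat`; a tangent vector is
timelike for any metric in the conformal class iff this form is negative on it. -/
def lorentzForm (w : E3 × ℝ) : ℝ := ‖w.1‖ ^ 2 - w.2 ^ 2

/-- A curve in the cylinder seen as a curve in the ambient vector space. -/
def ambient (c : ℝ → Cyl) (t : ℝ) : E3 × ℝ := ((c t).1.1, (c t).2)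

/-- The curve `c` is of class `C¹` near the time `t`, and its velocity at `t` is timelike and
future oriented. -/
def FutureTimelikeAt (c : ℝ → Cyl) (t : ℝ) : Prop :=
  ContDiffAt ℝ 1 (ambient c) t ∧
    lorentzForm (deriv (ambient c) t) < 0 ∧ 0 < (deriv (ambient c) t).2

/-- A subset of `einHat` is achronal if no timelike curve of `einHat` joins two of its points.
(A timelike curve is future oriented up to reversing its parametrization.) -/
def IsAchronal (L : Set Cyl) : Prop :=
  ¬ ∃ c : ℝ → Cyl, c 0 ∈ L ∧ c 1 ∈ L ∧
      ∀ t ∈ Icc (0 : ℝ) 1, FutureTimelikeAt c t ∧ ∀ᶠ s in 𝓝 t, c s ∈ einHat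

/-- The past lightcone in `einHat` of the point `p = (x, θ)`: the union of the two past oriented
lightlike segments from `p` to its opposite point `(-x, θ - π)`. -/
def pastLightcone (p : Cyl) : Set Cyl := {q | q ∈ einHat ∧ p.2 - q.2 = sphDist p.1 q.1}

/-- The future lightcone in `einHat` of a point. -/
def futureLightcone (p : Cyl) : Set Cyl := {q | q ∈ einHat ∧ q.2 - p.2 = sphDist p.1 q.1}

/-- `IsOpposite p q` says that `p = (-x, θ + π)` where `q = (x, θ)`; i.e. `p` and `q` are opposite
and `p` is the one in the future. -/
def IsOpposite (p q : Cyl) : Prop := p.1.1 = -q.1.1 ∧ p.2 = q.2 + Real.pi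

/-- A subset of `einHat` is pure lightlike if it is contained in the past lightcone and in the
future lightcone of two opposite elements of itself. -/
def IsPureLightlike (L : Set Cyl) : Prop :=
  ∃ p ∈ L, ∃ q ∈ L, IsOpposite p q ∧ L ⊆ pastLightcone p ∩ futureLightcone q

/-- Generic means not pure lightlike. -/
def IsGeneric (L : Set Cyl) : Prop := ¬ IsPureLightlike L

/-- The common future: points of `einHat` whose past lightcone contains `L`. -/
def commonFuture (L : Set Cyl) : Set Cyl := {p | p ∈ einHat ∧ L ⊆ pastLightcone p}

/-- The common past: points of `einHat` whose future lightcone contains `L`. -/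
def commonPast (L : Set Cyl) : Set Cyl := {p | p ∈ einHat ∧ L ⊆ futureLightcone p}

/-- `L` is nonelementary if its common future and its common past are both empty. -/
def IsNonelementary (L : Set Cyl) : Prop := commonFuture L = ∅ ∧ commonPast L = ∅

/-! ### Invisible domains -/

/-- `f₋(x) = sup {f(y) - d(x, y)}` where `L` is the graph of `f`. -/
def fMinus (L : Set Cyl) (x : Hemisphere) : ℝ := ⨆ p : L, (p.1.2 - sphDist x p.1.1)

/-- `f₊(x) = inf {f(y) + d(x, y)}` where `L` is the graph of `f`. -/
def fPlus (L : Set Cyl) (x : Hemisphere) : ℝ := ⨅ p : L, (p.1.2 + sphDist x p.1.1)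

/-- The invisible domain from `L` in the universal anti-de Sitter space. -/
def invisibleAdS (L : Set Cyl) : Set Cyl :=
  {p | p ∈ adsTilde ∧ fMinus L p.1 < p.2 ∧ p.2 < fPlus L p.1}

/-- The invisible domain from `L` in `einHat`. -/
def invisibleEin (L : Set Cyl) : Set Cyl :=
  {p | p ∈ einHat ∧ fMinus L p.1 < p.2 ∧ p.2 < fPlus L p.1}

/-! ### Isometry groups -/

/-- The Gram matrix of `Q = -u² - v² + x₁² + x₂²`. -/
def gramQ : Matrix (Fin 4) (Fin 4) ℝ := Matrix.diagonal ![-1, -1, 1, 1]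

/-- The group `O(2,2)`. -/
def O22 : Subgroup (GL (Fin 4) ℝ) where
  carrier := {A | A.1.transpose * gramQ * A.1 = gramQ}
  one_mem' := by simp
  mul_mem' := by
    intro A B hA hB
    simp only [mem_ofPred_eq, Units.val_mul, Matrix.transpose_mul] at *
    calc B.1.transpose * A.1.transpose * gramQ * (A.1 * B.1)
        = B.1.transpose * (A.1.transpose * gramQ * A.1) * B.1 := by simp only [Matrix.mul_assoc]
      _ = gramQ := by rw [hA, hB]
  inv_mem' := by
    intro A hA
    simp only [mem_ofPred_eq] at *
    have h1 : A.1 * (A⁻¹).1 = 1 := by rw [← Units.val_mul]; simp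
    have h2 : (A⁻¹).1.transpose * A.1.transpose = 1 := by
      rw [← Matrix.transpose_mul, h1, Matrix.transpose_one]
    calc (A⁻¹).1.transpose * gramQ * (A⁻¹).1
        = (A⁻¹).1.transpose * (A.1.transpose * gramQ * A.1) * (A⁻¹).1 := by rw [hA]
      _ = ((A⁻¹).1.transpose * A.1.transpose) * gramQ * (A.1 * (A⁻¹).1) := by
          simp only [Matrix.mul_assoc]
      _ = gramQ := by rw [h1, h2]; simp

/-- The group `SO₀(2,2)`, the neutral component of `O(2,2)`. -/
def SO22 : Subgroup (GL (Fin 4) ℝ) :=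
  (Subgroup.connectedComponentOfOne O22).map O22.subtype

/-- The vector `(cos t, sin t, x₀, x₁)` of `ℝ^{2,2}`.  The ray it spans is the image of `(x, t)`
under the covering of the closed Klein model: `adsTilde` is sent onto the rays of `{Q < 0}`
(the Klein model of AdS), and `einHat` onto the rays of `{Q = 0}`. -/
def toR22 (p : Cyl) : Fin 4 → ℝ := ![Real.cos p.2, Real.sin p.2, p.1.1 0, p.1.1 1]

/-- `φ` is a lift of the action of the matrix `A` on rays. -/
def IsLift (A : GL (Fin 4) ℝ) (φ : Cyl ≃ₜ Cyl) : Prop :=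
  ∀ p, ∃ r : ℝ, 0 < r ∧ toR22 (φ p) = r • (A.1.mulVec (toR22 p))

/-- The isometry group of the universal anti-de Sitter space (isometries preserving orientation
and time orientation), acting on the conformal completion: the group of all the lifts of the
elements of `SO₀(2,2)`. -/
def SO22Hat : Subgroup (Cyl ≃ₜ Cyl) where
  carrier := {φ | ∃ A ∈ SO22, IsLift A φ}
  one_mem' := ⟨1, one_mem _, fun p => ⟨1, one_pos, by simp⟩⟩
  mul_mem' := by
    rintro φ ψ ⟨A, hA, hφ⟩ ⟨B, hB, hψ⟩
    refine ⟨A * B, mul_mem hA hB, fun p => ?_⟩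
    obtain ⟨r, hr, h1⟩ := hφ (ψ p)
    obtain ⟨s, hs, h2⟩ := hψ p
    refine ⟨r * s, mul_pos hr hs, ?_⟩
    rw [Homeomorph.mul_apply, h1, h2, Matrix.mulVec_smul, Matrix.mulVec_mulVec, smul_smul,
      Units.val_mul]
  inv_mem' := by
    rintro φ ⟨A, hA, hφ⟩
    refine ⟨A⁻¹, inv_mem hA, fun p => ?_⟩
    obtain ⟨r, hr, h1⟩ := hφ (φ⁻¹ p)
    refine ⟨r⁻¹, inv_pos.mpr hr, ?_⟩
    have h3 : φ (φ⁻¹ p) = p := φ.apply_symm_apply p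
    have h4 : (A⁻¹).1 * A.1 = 1 := by rw [← Units.val_mul]; simp
    rw [h3] at h1
    rw [h1, Matrix.mulVec_smul, Matrix.mulVec_mulVec, h4, Matrix.one_mulVec, smul_smul,
      inv_mul_cancel₀ hr.ne', one_smul]

/-- Discreteness of a group of homeomorphisms, for the compact-open topology; on `SO22Hat` this
topology is the Lie group topology. -/
def IsDiscreteGroup (Γ : Subgroup (Cyl ≃ₜ Cyl)) : Prop :=
  DiscreteTopology ((fun φ : Cyl ≃ₜ Cyl => (φ : C(Cyl, Cyl))) '' (Γ : Set (Cyl ≃ₜ Cyl)))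

/-- `Γ` has no nontrivial element of finite order. -/
def IsTorsionFreeGroup (Γ : Subgroup (Cyl ≃ₜ Cyl)) : Prop :=
  ∀ γ ∈ Γ, IsOfFinOrder γ → γ = 1

/-- `Γ` leaves the set `S` invariant. -/
def Preserves (Γ : Subgroup (Cyl ≃ₜ Cyl)) (S : Set Cyl) : Prop := ∀ γ ∈ Γ, γ '' S = S

/-- `Γ` acts freely on `S`. -/
def ActsFreely (Γ : Subgroup (Cyl ≃ₜ Cyl)) (S : Set Cyl) : Prop :=
  ∀ γ ∈ Γ, ∀ p ∈ S, γ p = p → γ = 1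

/-- `Γ` acts properly discontinuously on `S`: a compact subset of `S` meets only finitely many of
its translates. -/
def ActsProperlyDiscontinuously (Γ : Subgroup (Cyl ≃ₜ Cyl)) (S : Set Cyl) : Prop :=
  ∀ C : Set Cyl, C ⊆ S → IsCompact C → {γ | γ ∈ Γ ∧ (γ '' C ∩ C).Nonempty}.Finite

/-! ### Quotient spacetimes -/

/-- Two points of `S` are equivalent if they are in the same `Γ`-orbit. -/
def orbitSetoid (Γ : Subgroup (Cyl ≃ₜ Cyl)) (S : Set Cyl) : Setoid S where
  r p q := ∃ γ ∈ Γ, γ p.1 = q.1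
  iseqv :=
    { refl := fun _ => ⟨1, one_mem _, rfl⟩
      symm := by
        rintro p q ⟨γ, hγ, h⟩
        exact ⟨γ⁻¹, inv_mem hγ, by rw [← h]; exact γ.symm_apply_apply p.1⟩
      trans := by
        rintro p q r ⟨γ, hγ, h⟩ ⟨η, hη, h'⟩
        exact ⟨η * γ, mul_mem hη hγ, by rw [Homeomorph.mul_apply, h, h']⟩ }

/-- The quotient `Γ \ S`, with its quotient topology. -/
abbrev QuotientSpace (Γ : Subgroup (Cyl ≃ₜ Cyl)) (S : Set Cyl) : Type := Quotient (orbitSetoid Γ S)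

/-- A future oriented timelike curve, parametrized by `[0,1]`, in the quotient spacetime `Γ \ S`.
The quotient is a spacetime locally isometric to `S`; so a curve in it is timelike if, near every
time, it is the projection of a timelike curve of `S`. -/
def IsFutureTimelikeCurve (Γ : Subgroup (Cyl ≃ₜ Cyl)) (S : Set Cyl)
    (c : ℝ → QuotientSpace Γ S) : Prop :=
  ∀ t ∈ Icc (0 : ℝ) 1, ∃ b : ℝ → Cyl, FutureTimelikeAt b t ∧
    ∀ᶠ s in 𝓝 t, ∃ h : b s ∈ S, c s = Quotient.mk (orbitSetoid Γ S) ⟨b s, h⟩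

/-- The future of a point in the quotient spacetime. -/
def future (Γ : Subgroup (Cyl ≃ₜ Cyl)) (S : Set Cyl) (a : QuotientSpace Γ S) :
    Set (QuotientSpace Γ S) :=
  {b | ∃ c, IsFutureTimelikeCurve Γ S c ∧ c 0 = a ∧ c 1 = b}

/-- The past of a point in the quotient spacetime. -/
def past (Γ : Subgroup (Cyl ≃ₜ Cyl)) (S : Set Cyl) (b : QuotientSpace Γ S) :
    Set (QuotientSpace Γ S) :=
  {a | ∃ c, IsFutureTimelikeCurve Γ S c ∧ c 0 = a ∧ c 1 = b}

/-- The Alexandrov topology of the quotient spacetime, generated by the common past-future regions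
`U(a, b)`, the intersection of the future of `a` with the past of `b`, for `b` in the future
of `a`. -/
@[reducible] def alexandrovTopology (Γ : Subgroup (Cyl ≃ₜ Cyl)) (S : Set Cyl) :
    TopologicalSpace (QuotientSpace Γ S) :=
  TopologicalSpace.generateFrom
    {U | ∃ a b, b ∈ future Γ S a ∧ U = future Γ S a ∩ past Γ S b}

/-- The quotient spacetime is strongly causal: its Alexandrov topology is its manifold topology,
which is the quotient topology. -/
def IsStronglyCausalQuotient (Γ : Subgroup (Cyl ≃ₜ Cyl)) (S : Set Cyl) : Prop :=
  alexandrovTopology Γ S = (inferInstance : TopologicalSpace (QuotientSpace Γ S))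

end AdSCausal

end

/-!
All the points of the cylinder are represented by rays of `ℝ^{2,2}`, and the argument is linear
algebra with the form `ip` of signature `(2, 2)`.  An achronal nonelementary set `L` is a compact
graph of a `1`-Lipschitz function, the two invisible domains consist of the points `p` with
`|Δt| < d` with respect to all the points of `L`, and then `ip p y < 0` for all `y ∈ L`.  That lifts
of elements of `O(2,2)` preserve this relation is `IsLift.abs_sub_lt`.

*Limits.*  A sequence of distinct elements of `Γ` lifts matrices `Aₙ` without bounded subsequence:
the deck transformations, which are lifts of the identity, are excluded by the compactness of `L`
(`exists_entry_gt`).  So some subsequence of the `Aₙ`, divided by their norms, converges to a matrix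
`B ≠ 0` (`DivergesTo`).  Its image is totally isotropic, and so is that of its adjoint, which is a
limit of the inverses.  A nonelementary set is not contained in the orthogonal of an isotropic
vector (`IsLimitSet.exists_ip_ne_zero`), hence not in the kernel of `B`; and `B` sends the points of
`L` outside its kernel to positive multiples of points of `L`.  Thus `ip p (B y) < 0` for these
points `y` and all invisible `p`, and likewise for the adjoint.

*Proper discontinuity.*  If `pₙ → p` and `γₙ pₙ → q` in the invisible domain, then `q` is
proportional to `B p`, so it is orthogonal to `B y` for `y ∈ L`, a contradiction.  Freeness follows,
since stabilizers are finite and `Γ` is torsion-free.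

*Strong causality.*  The chronological order of the cylinder is preserved by `Γ` (`IsLift.chron`),
and on the invisible domain `p` and `q` are timelike related if and only if
`ip p q + p₂ q₂ > 0`.  A point `p` is never in the past of `γ p`: otherwise the iterates of all
points near `p` increase to a common limit, so that `B` has rank one, and its image is spanned by a
point of `L` in the closed future of `p` (`not_chron_apply`).  Hence `ip x (A x) ≤ 0` for all
invisible `x` in the interior and the matrices `A` of elements of `Γ`.  If points close to `p` were
causally related to translates by `γₙ` of points close to `p`, the limit `B` would satisfy
`ip x (B x) ≤ 0` near `p` with equality at `p`, so the derivative at `p` in direction of `y ∈ L`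
vanishes; but it is `ip p (B y) + ip y (B p) < 0` if `B y ≠ 0` (`not_causal_of_injective`).  So small
diamonds of the quotient lift to small diamonds, and the topologies agree.
-/

open Set Filter Topology

noncomputable section

namespace AdSCausal

section

/-! ### The quadratic form and the hemisphere -/

/-- The symmetric bilinear form of signature `(2, 2)` polarizing `Q`. -/
def ip (u w : Fin 4 → ℝ) : ℝ := -(u 0 * w 0) - u 1 * w 1 + u 2 * w 2 + u 3 * w 3

lemma ip_comm (u w : Fin 4 → ℝ) : ip u w = ip w u := by simp only [ip]; ring

lemma ip_add_right (u v w : Fin 4 → ℝ) : ip u (v + w) = ip u v + ip u w := by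
  simp only [ip, Pi.add_apply]; ring

lemma ip_add_left (u v w : Fin 4 → ℝ) : ip (u + v) w = ip u w + ip v w := by
  simp only [ip, Pi.add_apply]; ring

lemma ip_smul_right (c : ℝ) (u w : Fin 4 → ℝ) : ip u (c • w) = c * ip u w := by
  simp only [ip, Pi.smul_apply, smul_eq_mul]; ring

lemma ip_smul_left (c : ℝ) (u w : Fin 4 → ℝ) : ip (c • u) w = c * ip u w := by
  simp only [ip, Pi.smul_apply, smul_eq_mul]; ring

lemma continuous_ip : Continuous fun p : (Fin 4 → ℝ) × (Fin 4 → ℝ) => ip p.1 p.2 := by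
  unfold ip; fun_prop

lemma tendsto_ip {ι : Type*} {F : Filter ι} {u w : ι → Fin 4 → ℝ} {u₀ w₀ : Fin 4 → ℝ}
    (hu : Tendsto u F (𝓝 u₀)) (hw : Tendsto w F (𝓝 w₀)) :
    Tendsto (fun i => ip (u i) (w i)) F (𝓝 (ip u₀ w₀)) :=
  (continuous_ip.tendsto (u₀, w₀)).comp (hu.prodMk_nhds hw)

lemma ip_eq_dotProduct (u w : Fin 4 → ℝ) : ip u w = u ⬝ᵥ gramQ.mulVec w := by
  simp [ip, gramQ, dotProduct, Fin.sum_univ_four, Matrix.mulVec_diagonal]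
  ring

/-- The adjoint of a matrix for the form of signature `(2, 2)`. -/
def adj (B : Matrix (Fin 4) (Fin 4) ℝ) : Matrix (Fin 4) (Fin 4) ℝ := gramQ * B.transpose * gramQ

lemma gramQ_mul_gramQ : gramQ * gramQ = 1 := by
  rw [gramQ, Matrix.diagonal_mul_diagonal, ← Matrix.diagonal_one]
  congr 1
  funext i
  fin_cases i <;> simp

lemma gramQ_transpose : gramQ.transpose = gramQ := Matrix.diagonal_transpose _

lemma ip_adj (B : Matrix (Fin 4) (Fin 4) ℝ) (u w : Fin 4 → ℝ) :
    ip u (B.mulVec w) = ip ((adj B).mulVec u) w := by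
  have h : gramQ * adj B = B.transpose * gramQ := by
    rw [adj, ← Matrix.mul_assoc, ← Matrix.mul_assoc, gramQ_mul_gramQ, Matrix.one_mul]
  rw [ip_comm u, ip_comm ((adj B).mulVec u), ip_eq_dotProduct, ip_eq_dotProduct,
    Matrix.mulVec_mulVec, h, ← Matrix.mulVec_mulVec, Matrix.dotProduct_mulVec w,
    Matrix.vecMul_transpose]

lemma adj_adj (B : Matrix (Fin 4) (Fin 4) ℝ) : adj (adj B) = B := by
  simp only [adj, Matrix.transpose_mul, Matrix.transpose_transpose, gramQ_transpose]
  calc gramQ * (gramQ * (B * gramQ)) * gramQ = (gramQ * gramQ) * B * (gramQ * gramQ) := by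
        simp only [Matrix.mul_assoc]
    _ = B := by rw [gramQ_mul_gramQ]; simp

lemma continuous_adj : Continuous adj := by
  unfold adj; fun_prop

lemma adj_smul (c : ℝ) (B : Matrix (Fin 4) (Fin 4) ℝ) : adj (c • B) = c • adj B := by
  simp [adj]

lemma adj_mul_self {A : GL (Fin 4) ℝ} (hA : A ∈ O22) : adj A.1 * A.1 = 1 := by
  have h : A.1.transpose * gramQ * A.1 = gramQ := hA
  rw [adj, Matrix.mul_assoc, Matrix.mul_assoc, ← Matrix.mul_assoc A.1.transpose, h,
    gramQ_mul_gramQ]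

/-- The inverse of an element of `O(2,2)` is its adjoint, which is defined for all matrices and hence
passes to limits. -/
lemma inv_eq_adj {A : GL (Fin 4) ℝ} (hA : A ∈ O22) : (A⁻¹).1 = adj A.1 := by
  have h2 : A.1 * (A⁻¹).1 = 1 := by rw [← Units.val_mul]; simp
  calc (A⁻¹).1 = (adj A.1 * A.1) * (A⁻¹).1 := by rw [adj_mul_self hA, Matrix.one_mul]
    _ = adj A.1 := by rw [Matrix.mul_assoc, h2, Matrix.mul_one]

lemma ip_mulVec {A : GL (Fin 4) ℝ} (hA : A ∈ O22) (u w : Fin 4 → ℝ) :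
    ip (A.1.mulVec u) (A.1.mulVec w) = ip u w := by
  rw [ip_adj, Matrix.mulVec_mulVec, adj_mul_self hA, Matrix.one_mulVec]

lemma SO22_le_O22 : SO22 ≤ O22 := by
  rintro A ⟨B, _, rfl⟩
  exact B.2

lemma coord_sq (x : Hemisphere) : x.1 0 ^ 2 + x.1 1 ^ 2 + x.1 2 ^ 2 = 1 := by
  have h := EuclideanSpace.norm_sq_eq x.1
  rw [x.2.1, Fin.sum_univ_three] at h
  simpa using h.symm

lemma inner_coord (x y : E3) : inner ℝ x y = x 0 * y 0 + x 1 * y 1 + x 2 * y 2 := by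
  rw [EuclideanSpace.inner_eq_star_dotProduct]
  simp [dotProduct, Fin.sum_univ_three]
  ring

lemma sphDist_comm (x y : Hemisphere) : sphDist x y = sphDist y x :=
  InnerProductGeometry.angle_comm _ _

lemma sphDist_nonneg (x y : Hemisphere) : 0 ≤ sphDist x y := InnerProductGeometry.angle_nonneg _ _

lemma sphDist_le_pi (x y : Hemisphere) : sphDist x y ≤ Real.pi :=
  InnerProductGeometry.angle_le_pi _ _

lemma Hemisphere.ne_zero (x : Hemisphere) : x.1 ≠ 0 := by
  intro h
  have := x.2.1
  rw [h, norm_zero] at this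
  exact zero_ne_one this

lemma sphDist_self (x : Hemisphere) : sphDist x x = 0 :=
  InnerProductGeometry.angle_self x.ne_zero

lemma sphDist_triangle (x y z : Hemisphere) : sphDist x z ≤ sphDist x y + sphDist y z :=
  InnerProductGeometry.angle_le_angle_add_angle _ _ _

/-- The perimeter of a spherical triangle is at most the length of a great circle. -/
lemma sphDist_perimeter (x y z : Hemisphere) :
    sphDist x y + sphDist x z + sphDist y z ≤ 2 * Real.pi := by
  have h := InnerProductGeometry.angle_le_angle_add_angle y.1 (-x.1) z.1
  rw [InnerProductGeometry.angle_neg_right, InnerProductGeometry.angle_neg_left] at h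
  have := InnerProductGeometry.angle_comm x.1 y.1
  unfold sphDist
  linarith

lemma cos_sphDist (x y : Hemisphere) :
    Real.cos (sphDist x y) = x.1 0 * y.1 0 + x.1 1 * y.1 1 + x.1 2 * y.1 2 := by
  rw [sphDist, InnerProductGeometry.cos_angle, x.2.1, y.2.1, inner_coord]
  simp

lemma continuous_sphDist : Continuous fun p : Hemisphere × Hemisphere => sphDist p.1 p.2 := by
  rw [continuous_iff_continuousAt]
  intro p
  have h := InnerProductGeometry.continuousAt_angle (x := ((p.1.1, p.2.1) : E3 × E3))
    p.1.ne_zero p.2.ne_zero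
  exact ContinuousAt.comp (f := fun p : Hemisphere × Hemisphere => ((p.1.1, p.2.1) : E3 × E3)) h
    (by fun_prop)

lemma eq_of_sphDist_eq_zero {x y : Hemisphere} (h : sphDist x y = 0) : x = y := by
  have h1 := cos_sphDist x y
  rw [h, Real.cos_zero] at h1
  have hx := coord_sq x
  have hy := coord_sq y
  have h3 : (x.1 0 - y.1 0) ^ 2 + (x.1 1 - y.1 1) ^ 2 + (x.1 2 - y.1 2) ^ 2 = 0 := by
    linear_combination hx + hy + 2 * h1
  apply Subtype.ext
  ext i
  have a0 := sq_nonneg (x.1 0 - y.1 0)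
  have a1 := sq_nonneg (x.1 1 - y.1 1)
  have a2 := sq_nonneg (x.1 2 - y.1 2)
  have b0 : (x.1 0 - y.1 0) ^ 2 = 0 := by linarith
  have b1 : (x.1 1 - y.1 1) ^ 2 = 0 := by linarith
  have b2 : (x.1 2 - y.1 2) ^ 2 = 0 := by linarith
  fin_cases i
  · exact sub_eq_zero.mp (pow_eq_zero_iff (two_ne_zero) |>.mp b0)
  · exact sub_eq_zero.mp (pow_eq_zero_iff (two_ne_zero) |>.mp b1)
  · exact sub_eq_zero.mp (pow_eq_zero_iff (two_ne_zero) |>.mp b2)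

/-- The chord between two points of the sphere is at most the arc. -/
lemma dist_le_sphDist (x y : Hemisphere) : dist x y ≤ sphDist x y := by
  have h0 := sphDist_nonneg x y
  have hc := Real.one_sub_sq_div_two_le_cos (x := sphDist x y)
  rw [Subtype.dist_eq, dist_eq_norm]
  apply abs_le_of_sq_le_sq' _ h0 |>.2
  rw [EuclideanSpace.norm_sq_eq, Fin.sum_univ_three]
  simp only [PiLp.sub_apply, Real.norm_eq_abs, sq_abs]
  rw [cos_sphDist] at hc
  nlinarith [coord_sq x, coord_sq y]

instance : CompactSpace Hemisphere := by
  apply isCompact_iff_compactSpace (s := {x : E3 | ‖x‖ = 1 ∧ 0 ≤ x 2}).mp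
  have h1 : IsCompact (Metric.sphere (0 : E3) 1) := isCompact_sphere 0 1
  have h2 : IsClosed {x : E3 | 0 ≤ x 2} :=
    isClosed_le continuous_const (by fun_prop)
  convert h1.inter_right h2 using 1
  ext x
  simp [Set.mem_inter_iff]

lemma coord_two_nonneg (x : Hemisphere) : 0 ≤ x.1 2 := x.2.2

lemma coord_two_le_one (x : Hemisphere) : x.1 2 ≤ 1 := by
  nlinarith [coord_sq x, sq_nonneg (x.1 0), sq_nonneg (x.1 1), x.2.2]

/-! ### The Klein model -/

lemma ip_toR22 (p q : Cyl) : ip (toR22 p) (toR22 q) =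
    Real.cos (sphDist p.1 q.1) - p.1.1 2 * q.1.1 2 - Real.cos (p.2 - q.2) := by
  rw [cos_sphDist, Real.cos_sub]
  simp [ip, toR22]
  ring

lemma ip_toR22_self (p : Cyl) : ip (toR22 p) (toR22 p) = -(p.1.1 2) ^ 2 := by
  rw [ip_toR22, sphDist_self, sub_self]; ring

lemma continuous_toR22 : Continuous toR22 := by
  unfold toR22
  refine continuous_pi fun i => ?_
  fin_cases i
  · simp; fun_prop
  · simp; fun_prop
  · simp; fun_prop
  · simp; fun_prop

lemma toR22_zero_sq_add (p : Cyl) : toR22 p 0 ^ 2 + toR22 p 1 ^ 2 = 1 := by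
  simp [toR22]

lemma toR22_ne_zero (p : Cyl) : toR22 p ≠ 0 := by
  intro h
  have := toR22_zero_sq_add p
  simp [h] at this

lemma abs_toR22_le (p : Cyl) (i : Fin 4) : |toR22 p i| ≤ 1 := by
  have h := coord_sq p.1
  have h' := toR22_zero_sq_add p
  rw [abs_le_one_iff_mul_self_le_one]
  fin_cases i
  · show toR22 p 0 * toR22 p 0 ≤ 1
    nlinarith [sq_nonneg (toR22 p 1)]
  · show toR22 p 1 * toR22 p 1 ≤ 1
    nlinarith [sq_nonneg (toR22 p 0)]
  · show p.1.1 0 * p.1.1 0 ≤ 1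
    nlinarith [sq_nonneg (p.1.1 1), sq_nonneg (p.1.1 2)]
  · show p.1.1 1 * p.1.1 1 ≤ 1
    nlinarith [sq_nonneg (p.1.1 0), sq_nonneg (p.1.1 2)]

/-- On the closed hemisphere, the third coordinate is a continuous function of the other two. -/
lemma hemisphere_tendsto {ι : Type*} {F : Filter ι} {x : ι → Hemisphere} {y : Hemisphere}
    (h0 : Tendsto (fun i => (x i).1 0) F (𝓝 (y.1 0)))
    (h1 : Tendsto (fun i => (x i).1 1) F (𝓝 (y.1 1))) : Tendsto x F (𝓝 y) := by
  have key : ∀ z : Hemisphere, z.1 2 = √(1 - z.1 0 ^ 2 - z.1 1 ^ 2) := fun z => by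
    have h := coord_sq z
    rw [show 1 - z.1 0 ^ 2 - z.1 1 ^ 2 = z.1 2 ^ 2 by linarith, Real.sqrt_sq z.2.2]
  have h2 : Tendsto (fun i => (x i).1 2) F (𝓝 (y.1 2)) := by
    simp only [key]
    exact (((h0.pow 2).const_sub 1).sub (h1.pow 2)).sqrt
  rw [tendsto_subtype_rng]
  have h3 : Tendsto (fun i => (x i).1.ofLp) F (𝓝 y.1.ofLp) := by
    rw [tendsto_pi_nhds]
    intro j
    fin_cases j
    exacts [h0, h1, h2]
  exact ((PiLp.continuous_toLp 2 _).tendsto y.1.ofLp).comp h3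

/-- The map `toR22` is injective on slabs of height at most `π`, with continuous inverse. -/
lemma tendsto_of_toR22 {ι : Type*} {F : Filter ι} {q : ι → Cyl} {p : Cyl}
    (h : Tendsto (fun i => toR22 (q i)) F (𝓝 (toR22 p)))
    (ht : ∀ᶠ i in F, |(q i).2 - p.2| ≤ Real.pi) : Tendsto q F (𝓝 p) := by
  have hi : ∀ j, Tendsto (fun i => toR22 (q i) j) F (𝓝 (toR22 p j)) := tendsto_pi_nhds.mp h
  have hx : Tendsto (fun i => (q i).1) F (𝓝 p.1) := hemisphere_tendsto (hi 2) (hi 3)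
  have hcos : Tendsto (fun i => Real.cos ((q i).2 - p.2)) F (𝓝 1) := by
    have := ((hi 0).mul_const (toR22 p 0)).add ((hi 1).mul_const (toR22 p 1))
    rw [show toR22 p 0 * toR22 p 0 + toR22 p 1 * toR22 p 1 = 1 by
      nlinarith [toR22_zero_sq_add p]] at this
    refine this.congr fun i => ?_
    rw [Real.cos_sub]; rfl
  have habs : Tendsto (fun i => |(q i).2 - p.2|) F (𝓝 0) := by
    have := (Real.continuous_arccos.tendsto 1).comp hcos
    rw [Real.arccos_one] at this
    refine this.congr' ?_
    filter_upwards [ht] with i hi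
    simp only [Function.comp]
    rw [← Real.cos_abs, Real.arccos_cos (abs_nonneg _) hi]
  have h2 : Tendsto (fun i => (q i).2) F (𝓝 p.2) := by
    rw [tendsto_iff_dist_tendsto_zero]
    simpa [Real.dist_eq] using habs
  exact hx.prodMk_nhds h2

end

section

/-! ### Spherical geodesics and timelike curves -/

/-- `q` lies in the chronological future of `p` in the cylinder over the closed hemisphere. -/
def Chron (p q : Cyl) : Prop := sphDist p.1 q.1 < q.2 - p.2

/-- `q` lies in the causal future of `p` in the cylinder over the closed hemisphere. -/
def Causal (p q : Cyl) : Prop := sphDist p.1 q.1 ≤ q.2 - p.2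

lemma Chron.causal {p q : Cyl} (h : Chron p q) : Causal p q := le_of_lt h

lemma Chron.trans_causal {p q r : Cyl} (h : Chron p q) (h' : Causal q r) : Chron p r := by
  have := sphDist_triangle p.1 q.1 r.1
  unfold Chron Causal at *
  linarith

lemma Causal.trans {p q r : Cyl} (h : Causal p q) (h' : Causal q r) : Causal p r := by
  have := sphDist_triangle p.1 q.1 r.1
  unfold Causal at *
  linarith

lemma Chron.trans {p q r : Cyl} (h : Chron p q) (h' : Chron q r) : Chron p r :=
  h.trans_causal h'.causal

lemma not_chron_self (p : Cyl) : ¬ Chron p p := by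
  simp [Chron, sphDist_self]

lemma Chron.lt {p q : Cyl} (h : Chron p q) : p.2 < q.2 := by
  have := sphDist_nonneg p.1 q.1
  unfold Chron at h
  linarith

lemma continuous_sphDist_fst :
    Continuous fun x : Cyl × Cyl => sphDist x.1.1 x.2.1 := by
  have h : Continuous fun x : Cyl × Cyl => (x.1.1, x.2.1) := by fun_prop
  simpa only [Function.comp_def] using continuous_sphDist.comp h

lemma continuous_time_sub : Continuous fun x : Cyl × Cyl => x.2.2 - x.1.2 :=
  (continuous_snd.comp continuous_snd).sub (continuous_snd.comp continuous_fst)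

lemma isOpen_chron : IsOpen {x : Cyl × Cyl | Chron x.1 x.2} :=
  isOpen_lt continuous_sphDist_fst continuous_time_sub

lemma isClosed_causal : IsClosed {x : Cyl × Cyl | Causal x.1 x.2} :=
  isClosed_le continuous_sphDist_fst continuous_time_sub

lemma norm_sq_coord (u : E3) : ‖u‖ ^ 2 = u 0 ^ 2 + u 1 ^ 2 + u 2 ^ 2 := by
  rw [EuclideanSpace.norm_sq_eq, Fin.sum_univ_three]
  simp

/-- The great circle through `x` with unit tangent vector `u`, run at speed `d`. -/
lemma great_circle (x : E3) (hx : ‖x‖ = 1) {u : E3} (hu : ‖u‖ = 1) (hxu : inner ℝ x u = 0)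
    (d : ℝ) (hd : 0 ≤ d) (s : ℝ) :
    ‖Real.cos (s * d) • x + Real.sin (s * d) • u‖ = 1 ∧
    inner ℝ x (Real.cos (s * d) • x + Real.sin (s * d) • u) = Real.cos (s * d) ∧
    ‖deriv (fun s : ℝ => Real.cos (s * d) • x + Real.sin (s * d) • u) s‖ = d := by
  have key : ∀ a b : ℝ, ‖a • x + b • u‖ ^ 2 = a ^ 2 + b ^ 2 := by
    intro a b
    rw [norm_add_sq_real, norm_smul, norm_smul, inner_smul_left, inner_smul_right, hxu, hx, hu]
    simp
  refine ⟨?_, ?_, ?_⟩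
  · have := key (Real.cos (s * d)) (Real.sin (s * d))
    rw [Real.cos_sq_add_sin_sq] at this
    rwa [← sq_eq_sq₀ (norm_nonneg _) zero_le_one, one_pow]
  · rw [inner_add_right, inner_smul_right, inner_smul_right, hxu, real_inner_self_eq_norm_sq, hx]
    simp
  · have h1 : HasDerivAt (fun s : ℝ => s * d) d s := by simpa using (hasDerivAt_id s).mul_const d
    have h2 : HasDerivAt (fun s : ℝ => Real.cos (s * d) • x + Real.sin (s * d) • u)
        ((-Real.sin (s * d) * d) • x + (Real.cos (s * d) * d) • u) s :=
      (h1.cos.smul_const x).add (h1.sin.smul_const u)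
    rw [h2.deriv, ← sq_eq_sq₀ (norm_nonneg _) hd, key]
    linear_combination d ^ 2 * Real.sin_sq_add_cos_sq (s * d)

/-- Two points of the closed hemisphere are joined by a great circle arc of the closed hemisphere,
parametrized at constant speed. -/
lemma exists_geodesic (x y : Hemisphere) : ∃ c : ℝ → E3, ContDiff ℝ 1 c ∧ c 0 = x.1 ∧ c 1 = y.1 ∧
    (∀ s, ‖c s‖ = 1) ∧ (∀ s, inner ℝ x.1 (c s) = Real.cos (s * sphDist x y)) ∧
    (∀ s, ‖deriv c s‖ = sphDist x y) ∧ (∀ s ∈ Icc (0 : ℝ) 1, 0 ≤ c s 2) ∧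
    (0 < x.1 2 → 0 < y.1 2 → ∀ s ∈ Icc (0 : ℝ) 1, 0 < c s 2) ∧
    (x.1 2 = 0 → y.1 2 = 0 → ∀ s, c s 2 = 0) := by
  set d := sphDist x y with hd
  have hd0 : 0 ≤ d := sphDist_nonneg x y
  have hdpi : d ≤ Real.pi := sphDist_le_pi x y
  have hcos := cos_sphDist x y
  rw [← hd] at hcos
  have hx := coord_sq x
  have hy := coord_sq y
  have smooth : ∀ u : E3, ContDiff ℝ 1
      (fun s : ℝ => Real.cos (s * d) • x.1 + Real.sin (s * d) • u) := fun u => by fun_prop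
  rcases hd0.eq_or_lt with h0 | h0
  · have hxy : x = y := eq_of_sphDist_eq_zero (by rw [← hd, ← h0])
    refine ⟨fun _ => x.1, contDiff_const, rfl, by rw [hxy], fun _ => x.2.1, fun s => ?_,
      fun s => ?_, fun _ _ => x.2.2, fun h _ _ _ => h, fun h _ _ => h⟩
    · rw [real_inner_self_eq_norm_sq, x.2.1, ← h0]; simp
    · rw [deriv_const, norm_zero, h0]
  rcases hdpi.eq_or_lt with h1 | h1
  · -- antipodal points of the equator, joined by a half equator
    have hcd : Real.cos d = -1 := by rw [h1, Real.cos_pi]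
    rw [hcd] at hcos
    have b0 := sq_nonneg (x.1 0 + y.1 0)
    have b1 := sq_nonneg (x.1 1 + y.1 1)
    have b2 := sq_nonneg (x.1 2 + y.1 2)
    have hs : (x.1 0 + y.1 0) ^ 2 + (x.1 1 + y.1 1) ^ 2 + (x.1 2 + y.1 2) ^ 2 = 0 := by
      linear_combination hx + hy - 2 * hcos
    have e0 : x.1 0 + y.1 0 = 0 := pow_eq_zero_iff two_ne_zero |>.mp (by linarith)
    have e1 : x.1 1 + y.1 1 = 0 := pow_eq_zero_iff two_ne_zero |>.mp (by linarith)
    have e2 : x.1 2 + y.1 2 = 0 := pow_eq_zero_iff two_ne_zero |>.mp (by linarith)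
    have hx2 : x.1 2 = 0 := by linarith [x.2.2, y.2.2]
    have hy2 : y.1 2 = 0 := by linarith
    set u : E3 := !₂[-x.1 1, x.1 0, 0] with hu
    have hu1 : ‖u‖ = 1 := by
      rw [← sq_eq_sq₀ (norm_nonneg _) zero_le_one, norm_sq_coord]
      simp [hu]
      nlinarith
    have hxu : inner ℝ x.1 u = 0 := by
      rw [inner_coord]
      simp [hu]
      ring
    have hc2 : ∀ s : ℝ, (Real.cos (s * d) • x.1 + Real.sin (s * d) • u) 2 = 0 := by
      intro s
      simp [hu, hx2]
    refine ⟨fun s => Real.cos (s * d) • x.1 + Real.sin (s * d) • u, smooth u, by simp, ?_,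
      fun s => (great_circle x.1 x.2.1 hu1 hxu d hd0 s).1,
      fun s => (great_circle x.1 x.2.1 hu1 hxu d hd0 s).2.1,
      fun s => (great_circle x.1 x.2.1 hu1 hxu d hd0 s).2.2, fun s _ => (hc2 s).ge,
      fun h => absurd hx2 h.ne', fun _ _ => hc2⟩
    simp only [one_mul, hcd]
    rw [h1, Real.sin_pi]
    ext i
    fin_cases i
    · simp; linarith
    · simp; linarith
    · simp; linarith
  · have hsin : 0 < Real.sin d := Real.sin_pos_of_pos_of_lt_pi h0 h1
    set u : E3 := (Real.sin d)⁻¹ • (y.1 - Real.cos d • x.1) with hu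
    have hin : inner ℝ x.1 y.1 = Real.cos d := by rw [inner_coord, hcos]
    have hu1 : ‖u‖ = 1 := by
      rw [← sq_eq_sq₀ (norm_nonneg _) zero_le_one, hu, norm_smul, mul_pow, norm_sub_sq_real,
        norm_smul, inner_smul_right, real_inner_comm, hin, x.2.1, y.2.1]
      simp only [norm_inv, Real.norm_eq_abs, mul_one, sq_abs, inv_pow]
      have := Real.sin_sq_add_cos_sq d
      field_simp
      linear_combination -this
    have hxu : inner ℝ x.1 u = 0 := by
      rw [hu, inner_smul_right, inner_sub_right, inner_smul_right, hin,
        real_inner_self_eq_norm_sq, x.2.1]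
      ring
    have hc2 : ∀ s : ℝ, Real.sin d * (Real.cos (s * d) • x.1 + Real.sin (s * d) • u) 2 =
        Real.sin ((1 - s) * d) * x.1 2 + Real.sin (s * d) * y.1 2 := by
      intro s
      rw [sub_mul, one_mul, Real.sin_sub]
      simp [hu]
      field_simp
      ring
    have hpos : ∀ s ∈ Icc (0 : ℝ) 1, 0 ≤ Real.sin (s * d) := fun s hs =>
      Real.sin_nonneg_of_nonneg_of_le_pi (mul_nonneg hs.1 hd0)
        ((mul_le_of_le_one_left hd0 hs.2).trans hdpi)
    have hpos' : ∀ s ∈ Icc (0 : ℝ) 1, 0 ≤ Real.sin ((1 - s) * d) := fun s hs =>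
      hpos (1 - s) ⟨by linarith [hs.2], by linarith [hs.1]⟩
    refine ⟨fun s => Real.cos (s * d) • x.1 + Real.sin (s * d) • u, smooth u, by simp, ?_,
      fun s => (great_circle x.1 x.2.1 hu1 hxu d hd0 s).1,
      fun s => (great_circle x.1 x.2.1 hu1 hxu d hd0 s).2.1,
      fun s => (great_circle x.1 x.2.1 hu1 hxu d hd0 s).2.2, fun s hs => ?_, fun hx2 hy2 s hs => ?_,
      fun hx2 hy2 s => ?_⟩
    · simp only [one_mul, hu, smul_smul, mul_inv_cancel₀ hsin.ne', one_smul]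
      abel
    · have h := hc2 s
      have h' := add_nonneg (mul_nonneg (hpos' s hs) x.2.2) (mul_nonneg (hpos s hs) y.2.2)
      rw [← h] at h'
      exact nonneg_of_mul_nonneg_right h' hsin
    · have h := hc2 s
      have h' : 0 < Real.sin ((1 - s) * d) * x.1 2 + Real.sin (s * d) * y.1 2 := by
        rcases hs.2.eq_or_lt with hs1 | hs1
        · rw [hs1]; simpa using mul_pos hsin hy2
        · refine add_pos_of_pos_of_nonneg (mul_pos (Real.sin_pos_of_pos_of_lt_pi ?_ ?_) hx2)
            (mul_nonneg (hpos s hs) hy2.le)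
          · exact mul_pos (by linarith) h0
          · nlinarith [hs.1]
      rw [← h] at h'
      exact pos_of_mul_pos_right h' hsin.le
    · have h := hc2 s
      rw [hx2, hy2, mul_zero, mul_zero, add_zero] at h
      exact (mul_eq_zero.mp h).resolve_left hsin.ne'

/-- Chronologically related points of the interior, or of the conformal boundary, are joined by a
timelike curve that stays there. -/
lemma Chron.exists_curve {p q : Cyl} (h : Chron p q) {S : Set Cyl}
    (hS : p ∈ adsTilde ∧ q ∈ adsTilde ∧ S = adsTilde ∨ p ∈ einHat ∧ q ∈ einHat ∧ S = einHat) :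
    ∃ b : ℝ → Cyl, b 0 = p ∧ b 1 = q ∧
      ∀ t ∈ Icc (0 : ℝ) 1, FutureTimelikeAt b t ∧ ∀ᶠ s in 𝓝 t, b s ∈ S := by
  classical
  obtain ⟨c, hc, hc0, hc1, hcn, -, hcd, -, hads, hein⟩ := exists_geodesic p.1 q.1
  have hcont : Continuous fun s => c s 2 := by have := hc.continuous; fun_prop
  have hS' : ∀ t ∈ Icc (0 : ℝ) 1, ∀ᶠ s in 𝓝 t,
      0 ≤ c s 2 ∧ ∀ r : Cyl, r.1.1 = c s → r ∈ S := by
    intro t ht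
    rcases hS with ⟨hp, hq, rfl⟩ | ⟨hp, hq, rfl⟩
    · filter_upwards [hcont.continuousAt.eventually_const_lt (hads hp hq t ht)] with s hs
      refine ⟨hs.le, fun r hr => ?_⟩
      show 0 < r.1.1 2
      rwa [hr]
    · refine Eventually.of_forall fun s => ⟨(hein hp hq s).ge, fun r hr => ?_⟩
      show r.1.1 2 = 0
      rw [hr, hein hp hq s]
  let b : ℝ → Cyl := fun s =>
    if h : 0 ≤ c s 2 then (⟨c s, hcn s, h⟩, p.2 + s * (q.2 - p.2)) else p
  have hb : ∀ s, 0 ≤ c s 2 → ambient b s = (c s, p.2 + s * (q.2 - p.2)) := by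
    intro s hs
    simp [ambient, b, hs]
  have hb' : ∀ s, 0 ≤ c s 2 → (b s).1.1 = c s := fun s hs => congrArg Prod.fst (hb s hs)
  refine ⟨b, ?_, ?_, fun t ht => ⟨?_, ?_⟩⟩
  · have : 0 ≤ c 0 2 := by rw [hc0]; exact p.1.2.2
    refine Prod.ext (Subtype.ext ?_) ?_
    · rw [hb' 0 this, hc0]
    · exact (congrArg Prod.snd (hb 0 this)).trans (by simp)
  · have : 0 ≤ c 1 2 := by rw [hc1]; exact q.1.2.2
    refine Prod.ext (Subtype.ext ?_) ?_
    · rw [hb' 1 this, hc1]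
    · exact (congrArg Prod.snd (hb 1 this)).trans (by simp)
  · have hev : ambient b =ᶠ[𝓝 t] fun s => (c s, p.2 + s * (q.2 - p.2)) := by
      filter_upwards [hS' t ht] with s hs using hb s hs.1
    have hder : HasDerivAt (fun s => (c s, p.2 + s * (q.2 - p.2)))
        (deriv c t, q.2 - p.2) t := by
      refine HasDerivAt.prodMk (hc.differentiable one_ne_zero t).hasDerivAt ?_
      simpa using ((hasDerivAt_id t).mul_const (q.2 - p.2)).const_add p.2
    have hd0 := sphDist_nonneg p.1 q.1
    unfold Chron at h
    refine ⟨ContDiffAt.congr_of_eventuallyEq ?_ hev, ?_, ?_⟩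
    · exact ContDiff.contDiffAt (by fun_prop)
    · rw [hev.deriv_eq, hder.deriv]
      simp only [lorentzForm, hcd]
      nlinarith
    · rw [hev.deriv_eq, hder.deriv]
      simp only
      linarith
  · filter_upwards [hS' t ht] with s hs using hs.2 _ (hb' s hs.1)

/-- The chord between two points of the sphere is at least the arc up to third order. -/
lemma chord_lower_bound (x y : Hemisphere) :
    sphDist x y * (1 - sphDist x y ^ 2 / 16) ≤ ‖x.1 - y.1‖ := by
  set a := sphDist x y with ha
  rcases (sphDist_nonneg x y).eq_or_lt with h0 | h0
  · rw [ha, ← h0]; simp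
  have h1 := Real.sin_gt_sub_cube (x := a / 2) (by positivity)
  have h2 : ‖x.1 - y.1‖ ^ 2 = (2 * Real.sin (a / 2)) ^ 2 := by
    have hc := cos_sphDist x y
    have hcos : Real.cos a = 1 - 2 * Real.sin (a / 2) ^ 2 := by
      have := Real.cos_two_mul (a / 2)
      have h3 := Real.sin_sq_add_cos_sq (a / 2)
      rw [mul_div_cancel₀ a two_ne_zero] at this
      linarith
    rw [← ha, hcos] at hc
    rw [norm_sq_coord]
    simp only [PiLp.sub_apply]
    linear_combination coord_sq x + coord_sq y + 2 * hc
  have h4 : 0 ≤ Real.sin (a / 2) :=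
    Real.sin_nonneg_of_nonneg_of_le_pi (by positivity) (by linarith [sphDist_le_pi x y])
  have h3 : ‖x.1 - y.1‖ = 2 * Real.sin (a / 2) :=
    (sq_eq_sq₀ (norm_nonneg _) (by linarith)).mp h2
  rw [h3]
  nlinarith

/-- Near `t`, the arc run on the sphere is smaller than the elapsed time: the difference quotients
converge to a timelike vector, and arcs are equivalent to chords.  The right hand side is the absolute
value of the time difference, written so that it covers both sides of `t`. -/
lemma FutureTimelikeAt.eventually_lt {b : ℝ → Cyl} {t : ℝ} (h : FutureTimelikeAt b t) :
    ∀ᶠ s in 𝓝[≠] t, sphDist (b t).1 (b s).1 < (s - t)⁻¹ * ((b s).2 - (b t).2) * |s - t| := by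
  obtain ⟨h1, h2, h3⟩ := h
  have hd := (h1.differentiableAt one_ne_zero).hasDerivAt
  set w := deriv (ambient b) t
  have hw : ‖w.1‖ < w.2 := by
    unfold lorentzForm at h2
    nlinarith [norm_nonneg w.1]
  obtain ⟨k₁, hk₁, hk₁'⟩ := exists_between hw
  obtain ⟨k₂, hk₂, hk₂'⟩ := exists_between hk₁'
  have hk₁0 : 0 < k₁ := (norm_nonneg _).trans_lt hk₁
  have hk₂0 : 0 < k₂ := hk₁0.trans hk₂
  have hsl := hasDerivAt_iff_tendsto_slope.mp hd
  have hs1 : Tendsto (fun s => ‖(slope (ambient b) t s).1‖) (𝓝[≠] t) (𝓝 ‖w.1‖) :=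
    ((continuous_fst.tendsto w).comp hsl).norm
  have hs2 : Tendsto (fun s => (slope (ambient b) t s).2) (𝓝[≠] t) (𝓝 w.2) :=
    (continuous_snd.tendsto w).comp hsl
  have hcont : Tendsto (fun s => (b s).1) (𝓝[≠] t) (𝓝 (b t).1) := by
    rw [tendsto_subtype_rng]
    exact ((continuous_fst.tendsto _).comp hd.continuousAt).mono_left nhdsWithin_le_nhds
  have ha : Tendsto (fun s => sphDist (b t).1 (b s).1) (𝓝[≠] t) (𝓝 0) := by
    have := (continuous_sphDist.tendsto ((b t).1, (b t).1)).comp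
      (tendsto_const_nhds.prodMk_nhds hcont)
    simpa [sphDist_self, Function.comp_def] using this
  have ha2 : Tendsto (fun s => 1 - sphDist (b t).1 (b s).1 ^ 2 / 16) (𝓝[≠] t) (𝓝 1) := by
    have := ((ha.pow 2).div_const 16).const_sub 1
    simpa using this
  filter_upwards [hs1.eventually_lt_const hk₁, hs2.eventually_const_lt hk₂',
    ha2.eventually_const_lt ((div_lt_one hk₂0).mpr hk₂),
    self_mem_nhdsWithin] with s e1 e2 e4 hst
  have hst' : 0 < |s - t| := abs_pos.mpr (sub_ne_zero.mpr hst)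
  simp only [slope, vsub_eq_sub, Prod.smul_fst, Prod.smul_snd, smul_eq_mul, ambient,
    Prod.fst_sub, Prod.snd_sub, norm_smul, norm_inv, Real.norm_eq_abs] at e1 e2
  rw [inv_mul_lt_iff₀ hst'] at e1
  have hch := chord_lower_bound (b s).1 (b t).1
  rw [sphDist_comm] at hch
  set a := sphDist (b t).1 (b s).1
  have ha0 : 0 ≤ a := sphDist_nonneg _ _
  have h5 : a * (k₁ / k₂) < |s - t| * k₁ :=
    ((mul_le_mul_of_nonneg_left e4.le ha0).trans hch).trans_lt e1
  have h6 : a < k₂ * |s - t| := by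
    rw [mul_div_assoc', div_lt_iff₀ hk₂0] at h5
    nlinarith
  exact h6.trans (mul_lt_mul_of_pos_right e2 hst')

/-- A timelike curve moves into the chronological future. -/
lemma FutureTimelikeAt.chron {b : ℝ → Cyl} {t : ℝ} (h : FutureTimelikeAt b t) :
    (∀ᶠ s in 𝓝[>] t, Chron (b t) (b s)) ∧ ∀ᶠ s in 𝓝[<] t, Chron (b s) (b t) := by
  have := h.eventually_lt
  constructor
  · filter_upwards [this.filter_mono (nhdsWithin_mono t fun s (hs : t < s) => hs.ne'),
      self_mem_nhdsWithin] with s hs hts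
    have hts : t < s := hts
    rw [abs_of_pos (sub_pos.mpr hts)] at hs
    have h0 : s - t ≠ 0 := (sub_pos.mpr hts).ne'
    unfold Chron
    calc _ < _ := hs
      _ = _ := by field_simp
  · filter_upwards [this.filter_mono (nhdsWithin_mono t fun s (hs : s < t) => hs.ne),
      self_mem_nhdsWithin] with s hs hts
    have hts : s < t := hts
    rw [abs_of_neg (sub_neg.mpr hts)] at hs
    have h0 : s - t ≠ 0 := (sub_neg.mpr hts).ne
    unfold Chron
    rw [sphDist_comm]
    calc _ < _ := hs
      _ = _ := by field_simp; ring

/-- A transitive relation that holds locally along a path holds between its end points. -/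
lemma rel_of_local {X : Type*} {R : X → X → Prop} (htrans : ∀ x y z, R x y → R y z → R x z)
    (c : ℝ → X) {a b : ℝ} (hab : a < b) (h : ∀ t ∈ Icc a b, (∀ᶠ s in 𝓝[>] t, R (c t) (c s)) ∧
      ∀ᶠ s in 𝓝[<] t, R (c s) (c t)) : R (c a) (c b) := by
  set S := {s | s ∈ Icc a b ∧ (s = a ∨ R (c a) (c s))} with hS
  have h0 : a ∈ S := ⟨left_mem_Icc.mpr hab.le, Or.inl rfl⟩
  have hbdd : BddAbove S := ⟨b, fun s hs => hs.1.2⟩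
  set t := sSup S with ht
  have ht0 : a ≤ t := le_csSup hbdd h0
  have ht1 : t ≤ b := csSup_le ⟨a, h0⟩ fun s hs => hs.1.2
  have htS : t ∈ S := by
    refine ⟨⟨ht0, ht1⟩, ?_⟩
    rcases ht0.eq_or_lt with h' | h'
    · exact Or.inl h'.symm
    right
    have := (h t ⟨ht0, ht1⟩).2
    obtain ⟨l, hl, hl'⟩ := (mem_nhdsLT_iff_exists_Ioo_subset' h').mp this
    obtain ⟨s, hs, hls⟩ := exists_lt_of_lt_csSup ⟨a, h0⟩ (show l < sSup S from hl)
    rcases (le_csSup hbdd hs).eq_or_lt with h2 | h2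
    · rcases hs.2 with h3 | h3
      · rw [← ht] at h2; linarith
      · rwa [h2] at h3
    · have h4 : R (c s) (c t) := hl' ⟨hls, h2⟩
      rcases hs.2 with h3 | h3
      · rwa [h3] at h4
      · exact htrans _ _ _ h3 h4
  rcases ht1.eq_or_lt with h1 | h1
  · rcases htS.2 with h3 | h3
    · linarith
    · rwa [h1] at h3
  · exfalso
    have := (h t ⟨ht0, ht1⟩).1
    obtain ⟨l, hl, hl'⟩ := (mem_nhdsGT_iff_exists_Ioo_subset' h1).mp this
    obtain ⟨s, hs, hs'⟩ := exists_between (lt_min (show t < l from hl) h1)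
    have h4 : R (c t) (c s) := hl' ⟨hs, hs'.trans_le (min_le_left _ _)⟩
    have h5 : s ∈ S := by
      refine ⟨⟨ht0.trans hs.le, (hs'.trans_le (min_le_right _ _)).le⟩, Or.inr ?_⟩
      rcases htS.2 with h3 | h3
      · rwa [h3] at h4
      · exact htrans _ _ _ h3 h4
    exact absurd (le_csSup hbdd h5) (not_le.mpr hs)

end

section

/-! ### Achronal sets and their invisible domains -/

lemma IsAchronal.abs_sub_le {L : Set Cyl} (hL : L ⊆ einHat) (h : IsAchronal L) {p q : Cyl}
    (hp : p ∈ L) (hq : q ∈ L) : |p.2 - q.2| ≤ sphDist p.1 q.1 := by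
  have key : ∀ p ∈ L, ∀ q ∈ L, q.2 - p.2 ≤ sphDist p.1 q.1 := by
    intro p hp q hq
    by_contra hlt
    obtain ⟨b, hb0, hb1, hb⟩ := Chron.exists_curve (p := p) (q := q) (not_le.mp hlt)
      (S := einHat) (Or.inr ⟨hL hp, hL hq, rfl⟩)
    exact h ⟨b, hb0 ▸ hp, hb1 ▸ hq, hb⟩
  rw [abs_le]
  have h1 := key p hp q hq
  have h2 := key q hq p hp
  rw [sphDist_comm] at h2
  constructor <;> linarith

/-- The standing assumptions on the invariant subset of the conformal boundary, in the form in which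
they are used: it is a compact nonempty graph of a `1`-Lipschitz function and it is nonelementary. -/
structure IsLimitSet (L : Set Cyl) : Prop where
  subset : L ⊆ einHat
  isCompact : IsCompact L
  nonempty : L.Nonempty
  abs_sub_le : ∀ p ∈ L, ∀ q ∈ L, |p.2 - q.2| ≤ sphDist p.1 q.1
  nonelementary : IsNonelementary L

lemma isLimitSet_of_isAchronal {L : Set Cyl} (hL : L ⊆ einHat) (hclosed : IsClosed L)
    (hach : IsAchronal L) (hne : IsNonelementary L) : IsLimitSet L := by
  have hlip : ∀ p ∈ L, ∀ q ∈ L, |p.2 - q.2| ≤ sphDist p.1 q.1 :=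
    fun p hp q hq => hach.abs_sub_le hL hp hq
  have hnonempty : L.Nonempty := by
    by_contra hempty
    rw [not_nonempty_iff_eq_empty] at hempty
    have hx : ‖(!₂[1, 0, 0] : E3)‖ = 1 ∧ 0 ≤ (!₂[1, 0, 0] : E3) 2 := by
      refine ⟨?_, by simp⟩
      rw [← sq_eq_sq₀ (norm_nonneg _) zero_le_one, norm_sq_coord]
      simp
    have : ((⟨!₂[1, 0, 0], hx⟩ : Hemisphere), (0 : ℝ)) ∈ commonFuture L :=
      ⟨by simp [einHat], by simp [hempty]⟩
    rw [hne.1] at this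
    exact this
  obtain ⟨p, hp⟩ := hnonempty
  refine ⟨hL, ?_, ⟨p, hp⟩, hlip, hne⟩
  have hK : IsCompact ((univ : Set Hemisphere) ×ˢ Icc (p.2 - Real.pi) (p.2 + Real.pi)) :=
    isCompact_univ.prod isCompact_Icc
  refine hK.of_isClosed_subset hclosed fun q hq => ⟨mem_univ _, ?_⟩
  have h := abs_le.mp ((hlip p hp q hq).trans (sphDist_le_pi _ _))
  exact ⟨by linarith [h.2], by linarith [h.1]⟩

/-- The points of the cylinder that are not causally related to any point of `L`. -/
def invisible (L : Set Cyl) : Set Cyl := {p | ∀ q ∈ L, |p.2 - q.2| < sphDist p.1 q.1}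

variable {L : Set Cyl}

lemma fMinus_lt_iff (hL : IsLimitSet L) (p : Cyl) :
    fMinus L p.1 < p.2 ↔ ∀ q ∈ L, q.2 - sphDist p.1 q.1 < p.2 := by
  have : Nonempty L := hL.nonempty.to_subtype
  have hcont : Continuous fun q : Cyl => q.2 - sphDist p.1 q.1 := by
    have h : Continuous fun q : Cyl => ((p, q) : Cyl × Cyl) := by fun_prop
    have h' := continuous_sphDist_fst.comp h
    simp only [Function.comp_def] at h'
    exact continuous_snd.sub h'
  obtain ⟨q₀, hq₀, hmax⟩ := hL.isCompact.exists_isMaxOn hL.nonempty hcont.continuousOn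
  have hb : BddAbove (range fun q : L => q.1.2 - sphDist p.1 q.1.1) :=
    ⟨_, by rintro _ ⟨q, rfl⟩; exact hmax q.2⟩
  constructor
  · intro h q hq
    exact (le_ciSup hb ⟨q, hq⟩).trans_lt h
  · intro h
    exact (ciSup_le fun q : L => hmax q.2).trans_lt (h q₀ hq₀)

lemma lt_fPlus_iff (hL : IsLimitSet L) (p : Cyl) :
    p.2 < fPlus L p.1 ↔ ∀ q ∈ L, p.2 < q.2 + sphDist p.1 q.1 := by
  have : Nonempty L := hL.nonempty.to_subtype
  have hcont : Continuous fun q : Cyl => q.2 + sphDist p.1 q.1 := by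
    have h : Continuous fun q : Cyl => ((p, q) : Cyl × Cyl) := by fun_prop
    have h' := continuous_sphDist_fst.comp h
    simp only [Function.comp_def] at h'
    exact continuous_snd.add h'
  obtain ⟨q₀, hq₀, hmin⟩ := hL.isCompact.exists_isMinOn hL.nonempty hcont.continuousOn
  have hb : BddBelow (range fun q : L => q.1.2 + sphDist p.1 q.1.1) :=
    ⟨_, by rintro _ ⟨q, rfl⟩; exact hmin q.2⟩
  constructor
  · intro h q hq
    exact h.trans_le (ciInf_le hb ⟨q, hq⟩)
  · intro h
    exact (h q₀ hq₀).trans_le (le_ciInf fun q : L => hmin q.2)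

lemma mem_invisible_iff (hL : IsLimitSet L) (p : Cyl) :
    p ∈ invisible L ↔ fMinus L p.1 < p.2 ∧ p.2 < fPlus L p.1 := by
  rw [fMinus_lt_iff hL, lt_fPlus_iff hL]
  constructor
  · intro h
    refine ⟨fun q hq => ?_, fun q hq => ?_⟩ <;> have := abs_lt.mp (h q hq) <;> linarith
  · rintro ⟨h1, h2⟩ q hq
    rw [abs_lt]
    constructor <;> linarith [h1 q hq, h2 q hq]

lemma invisibleAdS_eq (hL : IsLimitSet L) : invisibleAdS L = adsTilde ∩ invisible L := by
  ext p
  exact and_congr_right fun _ => (mem_invisible_iff hL p).symm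

lemma invisibleEin_eq (hL : IsLimitSet L) : invisibleEin L = einHat ∩ invisible L := by
  ext p
  exact and_congr_right fun _ => (mem_invisible_iff hL p).symm

lemma isOpen_invisible (hL : IsLimitSet L) : IsOpen (invisible L) := by
  have : CompactSpace L := isCompact_iff_compactSpace.mp hL.isCompact
  have hcl : IsClosed {x : Cyl × L | sphDist x.1.1 x.2.1.1 ≤ |x.1.2 - x.2.1.2|} := by
    have h : Continuous fun x : Cyl × L => ((x.1, x.2.1) : Cyl × Cyl) := by fun_prop
    have h' := continuous_sphDist_fst.comp h
    have h'' := (continuous_time_sub.comp h).abs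
    simp only [Function.comp_def] at h' h''
    simp only [abs_sub_comm _ (Prod.snd (Subtype.val _))]
    exact isClosed_le h' h''
  have := (isClosedMap_fst_of_compactSpace (X := Cyl) (Y := L)) _ hcl
  convert this.isOpen_compl using 1
  ext p
  simp only [invisible, mem_compl_iff, mem_image, Prod.exists, exists_and_right, exists_eq_right]
  constructor
  · rintro h ⟨q, hq⟩
    exact absurd (h q.1 q.2) (not_lt.mpr hq)
  · intro h q hq
    by_contra hlt
    exact h ⟨⟨q, hq⟩, not_lt.mp hlt⟩

lemma isOpen_adsTilde : IsOpen adsTilde := by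
  have h : Continuous fun p : Cyl => p.1.1 2 := by fun_prop
  exact isOpen_lt continuous_const h

/-- Points between two points of the invisible domain are in the invisible domain. -/
lemma mem_invisible_of_causal {p q r : Cyl} (hp : p ∈ invisible L) (hr : r ∈ invisible L)
    (hpq : Causal p q) (hqr : Causal q r) : q ∈ invisible L := by
  intro y hy
  have h1 := abs_lt.mp (hp y hy)
  have h2 := abs_lt.mp (hr y hy)
  have h3 := sphDist_triangle p.1 q.1 y.1
  have h4 := sphDist_triangle r.1 q.1 y.1
  rw [sphDist_comm r.1 q.1] at h4
  unfold Causal at hpq hqr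
  rw [abs_lt]
  constructor <;> linarith

lemma ip_neg_of_invisible (hL : IsLimitSet L) {p q : Cyl} (hp : p ∈ invisible L) (hq : q ∈ L) :
    ip (toR22 p) (toR22 q) < 0 := by
  have h := hp q hq
  have hq2 : q.1.1 2 = 0 := hL.subset hq
  rw [ip_toR22, hq2, mul_zero, sub_zero, sub_neg, ← Real.cos_abs (p.2 - q.2)]
  exact Real.cos_lt_cos_of_nonneg_of_le_pi (abs_nonneg _) (sphDist_le_pi _ _) h

/-- For points of the invisible domain, being timelike related is read off the bilinear form: by the
bound on the perimeter of spherical triangles, their time difference is less than `2π - d`, which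
excludes that the form sees a translate by `2π`. -/
lemma chron_or_chron_iff (hL : IsLimitSet L) {p q : Cyl} (hp : p ∈ invisible L)
    (hq : q ∈ invisible L) :
    Chron p q ∨ Chron q p ↔ 0 < ip (toR22 p) (toR22 q) + p.1.1 2 * q.1.1 2 := by
  obtain ⟨y, hy⟩ := hL.nonempty
  have h1 := abs_lt.mp (hp y hy)
  have h2 := abs_lt.mp (hq y hy)
  have h3 := sphDist_perimeter p.1 q.1 y.1
  have h4 := sphDist_nonneg p.1 q.1
  have h6 := sphDist_le_pi p.1 q.1
  have h5 : |p.2 - q.2| < 2 * Real.pi - sphDist p.1 q.1 := by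
    rw [abs_lt]; constructor <;> linarith
  have h7 : Chron p q ∨ Chron q p ↔ sphDist p.1 q.1 < |p.2 - q.2| := by
    rw [lt_abs, or_comm, Chron, Chron, sphDist_comm q.1, neg_sub]
  rw [h7, ip_toR22, ← Real.cos_abs (p.2 - q.2)]
  set t := |p.2 - q.2| with ht
  have ht0 : 0 ≤ t := abs_nonneg _
  constructor
  · intro h
    rcases le_total t Real.pi with hpi | hpi
    · have := Real.cos_lt_cos_of_nonneg_of_le_pi h4 hpi h
      linarith
    · have := Real.cos_lt_cos_of_nonneg_of_le_pi (x := sphDist p.1 q.1) (y := 2 * Real.pi - t) h4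
        (by linarith) (by linarith)
      rw [Real.cos_two_pi_sub] at this
      linarith
  · intro h
    by_contra hle
    have := Real.cos_le_cos_of_nonneg_of_le_pi ht0 h6 (not_lt.mp hle)
    linarith

lemma ip_nonneg_of_causal (hL : IsLimitSet L) {p q : Cyl} (hp : p ∈ invisible L)
    (hq : q ∈ invisible L) (h : Causal p q) : 0 ≤ ip (toR22 p) (toR22 q) + p.1.1 2 * q.1.1 2 := by
  rcases h.eq_or_lt with h | h
  · rw [ip_toR22, h, ← Real.cos_neg (p.2 - q.2), neg_sub]
    linarith
  · exact ((chron_or_chron_iff hL hp hq).mp (Or.inl h)).le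

/-! ### Nonelementary sets and isotropic vectors -/

/-- Two dimensional Gram identity. -/
lemma gram_identity (x₀ x₁ y₀ y₁ a₀ a₁ b₀ b₁ : ℝ) :
    ((a₀ ^ 2 + a₁ ^ 2) * (b₀ ^ 2 + b₁ ^ 2) - (a₀ * b₀ + a₁ * b₁) ^ 2) * (x₀ * y₀ + x₁ * y₁) =
      (x₀ * a₀ + x₁ * a₁) * (y₀ * a₀ + y₁ * a₁) * (b₀ ^ 2 + b₁ ^ 2) +
      (x₀ * b₀ + x₁ * b₁) * (y₀ * b₀ + y₁ * b₁) * (a₀ ^ 2 + a₁ ^ 2) -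
      (a₀ * b₀ + a₁ * b₁) * ((x₀ * a₀ + x₁ * a₁) * (y₀ * b₀ + y₁ * b₁) +
        (x₀ * b₀ + x₁ * b₁) * (y₀ * a₀ + y₁ * a₁)) := by ring

/-- A totally isotropic plane is its own orthogonal. -/
lemma ip_eq_zero_of_orthogonal {a b x y : Fin 4 → ℝ} (ha : a 0 ^ 2 + a 1 ^ 2 = 1)
    (ha' : ip a a = 0) (hb : b 0 ^ 2 + b 1 ^ 2 = 1) (hb' : ip b b = 0) (hab : ip a b = 0)
    (hne : (a 0 * b 0 + a 1 * b 1) ^ 2 ≠ 1) (hxa : ip x a = 0) (hxb : ip x b = 0)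
    (hya : ip y a = 0) (hyb : ip y b = 0) : ip x y = 0 := by
  have h1 := gram_identity (x 0) (x 1) (y 0) (y 1) (a 0) (a 1) (b 0) (b 1)
  have h2 := gram_identity (x 2) (x 3) (y 2) (y 3) (a 2) (a 3) (b 2) (b 3)
  unfold ip at *
  have ea : a 2 ^ 2 + a 3 ^ 2 = 1 := by linarith
  have eb : b 2 ^ 2 + b 3 ^ 2 = 1 := by linarith
  have e1 : a 2 * b 2 + a 3 * b 3 = a 0 * b 0 + a 1 * b 1 := by linarith
  have e2 : x 2 * a 2 + x 3 * a 3 = x 0 * a 0 + x 1 * a 1 := by linarith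
  have e3 : x 2 * b 2 + x 3 * b 3 = x 0 * b 0 + x 1 * b 1 := by linarith
  have e4 : y 2 * a 2 + y 3 * a 3 = y 0 * a 0 + y 1 * a 1 := by linarith
  have e5 : y 2 * b 2 + y 3 * b 3 = y 0 * b 0 + y 1 * b 1 := by linarith
  rw [ea, eb, e1, e2, e3, e4, e5] at h2
  rw [ha, hb] at h1
  have h3 := h2.trans h1.symm
  have h4 : 1 * 1 - (a 0 * b 0 + a 1 * b 1) ^ 2 ≠ 0 := by
    intro h; apply hne; linarith
  have h5 := mul_left_cancel₀ h4 h3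
  linarith

lemma eq_of_cos_eq {s d : ℝ} (hs : s ∈ Icc 0 Real.pi) (hd : d ∈ Icc 0 Real.pi)
    (h : Real.cos d = Real.cos s) : s = d := (Real.injOn_cos hd hs h).symm

lemma ip_eq_zero_iff {p q : Cyl} (hp : p ∈ einHat) :
    ip (toR22 p) (toR22 q) = 0 ↔ Real.cos (sphDist p.1 q.1) = Real.cos (p.2 - q.2) := by
  have hp' : p.1.1 2 = 0 := hp
  rw [ip_toR22, hp', zero_mul, sub_zero, sub_eq_zero]

/-- A nonzero isotropic vector is represented, up to sign, by a point of the boundary in every time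
interval of length `π`. -/
lemma exists_vertex {v : Fin 4 → ℝ} (hv0 : v ≠ 0) (hv : ip v v = 0) (t : ℝ) :
    ∃ w ∈ einHat, t < w.2 ∧ w.2 ≤ t + Real.pi ∧ ∃ l : ℝ, toR22 w = l • v := by
  set z : ℂ := ⟨v 0, v 1⟩ with hz
  set θ := Complex.arg z with hθ
  set ρ := ‖z‖ with hρ
  have e0 : ρ * Real.cos θ = v 0 := Complex.norm_mul_cos_arg z
  have e1 : ρ * Real.sin θ = v 1 := Complex.norm_mul_sin_arg z
  have hρ0 : ρ ≠ 0 := by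
    intro h
    rw [h, zero_mul] at e0 e1
    apply hv0
    unfold ip at hv
    rw [← e0, ← e1] at hv
    funext i
    fin_cases i
    · exact e0.symm
    · exact e1.symm
    · show v 2 = 0
      nlinarith [sq_nonneg (v 2), sq_nonneg (v 3)]
    · show v 3 = 0
      nlinarith [sq_nonneg (v 2), sq_nonneg (v 3)]
  obtain ⟨k, ⟨hk1, hk2⟩, -⟩ := existsUnique_add_zsmul_mem_Ioc Real.pi_pos θ t
  rw [zsmul_eq_mul] at hk1 hk2
  set θ' := θ + k * Real.pi with hθ'
  have hsign : ∃ ε : ℝ, ε ^ 2 = 1 ∧ Real.cos θ' = ε * Real.cos θ ∧ Real.sin θ' = ε * Real.sin θ :=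
    ⟨(-1) ^ k, by rw [← zpow_natCast, zpow_comm]; norm_num,
      Real.cos_add_int_mul_pi θ k, Real.sin_add_int_mul_pi θ k⟩
  obtain ⟨ε, hε, hc, hs⟩ := hsign
  set l := ε / ρ with hl
  have hl2 : l ^ 2 * (v 2 ^ 2 + v 3 ^ 2) = 1 := by
    have h1 : v 2 ^ 2 + v 3 ^ 2 = ρ ^ 2 := by
      unfold ip at hv
      have := Real.sin_sq_add_cos_sq θ
      rw [← e0, ← e1] at hv
      linear_combination hv + ρ ^ 2 * this
    rw [h1, hl, div_pow, hε]
    field_simp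
  have hx : ‖(!₂[l * v 2, l * v 3, 0] : E3)‖ = 1 ∧ 0 ≤ (!₂[l * v 2, l * v 3, 0] : E3) 2 := by
    refine ⟨?_, by simp⟩
    rw [← sq_eq_sq₀ (norm_nonneg _) zero_le_one, norm_sq_coord]
    simp
    linear_combination hl2
  refine ⟨(⟨!₂[l * v 2, l * v 3, 0], hx⟩, θ'), by simp [einHat], hk1, hk2, l, ?_⟩
  funext i
  fin_cases i
  · show Real.cos θ' = l * v 0
    rw [hc, hl, ← e0]; field_simp
  · show Real.sin θ' = l * v 1
    rw [hs, hl, ← e1]; field_simp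
  · simp [toR22]
  · simp [toR22]

/-- A nonelementary set is not contained in the orthogonal of an isotropic vector.  Otherwise it
lies on the light rays through the representatives of this vector: either it lies below one of
them, hence in its past lightcone, or it goes through one of them along a single light ray, and it
lies in the future lightcone of its lowest point. -/
lemma IsLimitSet.exists_ip_ne_zero (hL : IsLimitSet L) {v : Fin 4 → ℝ} (hv0 : v ≠ 0)
    (hv : ip v v = 0) : ∃ y ∈ L, ip v (toR22 y) ≠ 0 := by
  by_contra! hall
  obtain ⟨q, hq, hmin⟩ := hL.isCompact.exists_isMinOn hL.nonempty continuous_snd.continuousOn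
  replace hmin : ∀ y ∈ L, q.2 ≤ y.2 := fun y hy => hmin hy
  obtain ⟨w, hw, hw1, hw2, l, hl⟩ := exists_vertex hv0 hv q.2
  have horth : ∀ y ∈ L, ip (toR22 w) (toR22 y) = 0 := fun y hy => by
    rw [hl, ip_smul_left, hall y hy, mul_zero]
  have hcos : ∀ y ∈ L, Real.cos (sphDist w.1 y.1) = Real.cos (w.2 - y.2) := fun y hy =>
    (ip_eq_zero_iff hw).mp (horth y hy)
  have hd : ∀ x y : Hemisphere, sphDist x y ∈ Icc 0 Real.pi := fun x y =>
    ⟨sphDist_nonneg x y, sphDist_le_pi x y⟩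
  have hle : ∀ x ∈ L, ∀ y ∈ L, y.2 - x.2 ≤ sphDist x.1 y.1 := fun x hx y hy => by
    have := (abs_le.mp (hL.abs_sub_le x hx y hy)).1
    linarith
  have hbelow : ∀ y ∈ L, y.2 ≤ w.2 → w.2 - y.2 = sphDist w.1 y.1 := fun y hy h =>
    eq_of_cos_eq ⟨by linarith, by linarith [hmin y hy]⟩ (hd _ _) (hcos y hy)
  have habove : ∀ y ∈ L, w.2 < y.2 → y.2 - w.2 = sphDist w.1 y.1 := fun y hy h =>
    eq_of_cos_eq ⟨by linarith, by linarith [hle q hq y hy, sphDist_le_pi q.1 y.1]⟩ (hd _ _)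
      (by rw [hcos y hy, ← Real.cos_neg, neg_sub])
  -- the case where `L` lies below the vertex `w`
  by_cases hcase : ∀ y ∈ L, y.2 ≤ w.2
  · have : w ∈ commonFuture L :=
      ⟨hw, fun y hy => ⟨hL.subset hy, hbelow y hy (hcase y hy)⟩⟩
    rw [hL.nonelementary.1] at this
    exact this
  push Not at hcase
  obtain ⟨q', hq', hwq'⟩ := hcase
  have hww := ip_toR22_self w
  have hqq := ip_toR22_self q'
  have hw2' : w.1.1 2 = 0 := hw
  have hq2' : q'.1.1 2 = 0 := hL.subset hq'
  -- the light rays from `y` up to `w` and from `w` up to `q'` realize the distance of `y` and `q'`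
  have hnull : ∀ y ∈ L, y.2 ≤ w.2 → ip (toR22 y) (toR22 q') = 0 := fun y hy h => by
    have h1 := hbelow y hy h
    have h2 := habove q' hq' hwq'
    have h3 := sphDist_triangle y.1 w.1 q'.1
    rw [sphDist_comm y.1 w.1] at h3
    have h4 := hle y hy q' hq'
    rw [ip_eq_zero_iff (hL.subset hy), ← Real.cos_neg (y.2 - q'.2), neg_sub]
    congr 1
    linarith
  have : q ∈ commonPast L := by
    refine ⟨hL.subset hq, fun y hy => ⟨hL.subset hy, ?_⟩⟩
    have h4 := hle q hq y hy
    rcases lt_or_ge w.2 y.2 with h | h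
    · have h1 := hbelow q hq hw1.le
      have h2 := habove y hy h
      have h3 := sphDist_triangle q.1 w.1 y.1
      rw [sphDist_comm q.1 w.1] at h3
      linarith
    · -- both `q` and `y` are orthogonal to the isotropic plane spanned by `w` and `q'`
      refine eq_of_cos_eq ⟨by linarith [hmin y hy], by linarith [sphDist_le_pi q.1 y.1]⟩ (hd _ _) ?_
      rw [← Real.cos_neg (y.2 - q.2), neg_sub, ← ip_eq_zero_iff (hL.subset hq)]
      refine ip_eq_zero_of_orthogonal (toR22_zero_sq_add w) (by rw [hww, hw2']; simp)
        (toR22_zero_sq_add q') (by rw [hqq, hq2']; simp) (horth q' hq') ?_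
        ((ip_comm _ _).trans (horth q hq)) (hnull q hq hw1.le)
        ((ip_comm _ _).trans (horth y hy)) (hnull y hy h)
      have hc : toR22 w 0 * toR22 q' 0 + toR22 w 1 * toR22 q' 1 = Real.cos (q'.2 - w.2) := by
        rw [Real.cos_sub]; simp [toR22]; ring
      rw [hc]
      intro hone
      have h5 : 0 < Real.sin (q'.2 - w.2) := Real.sin_pos_of_pos_of_lt_pi (by linarith)
        (by linarith [hle q hq q' hq', sphDist_le_pi q.1 q'.1])
      have := Real.sin_sq_add_cos_sq (q'.2 - w.2)
      nlinarith
  rw [hL.nonelementary.2] at this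
  exact this

end

section

/-! ### Lifts of isometries -/

variable {L : Set Cyl} {A : GL (Fin 4) ℝ} {φ : Cyl ≃ₜ Cyl} {Γ : Subgroup (Cyl ≃ₜ Cyl)}

lemma IsLift.spec (hA : A ∈ O22) (h : IsLift A φ) (p : Cyl) :
    ∃ r : ℝ, 0 < r ∧ toR22 (φ p) = r • A.1.mulVec (toR22 p) ∧ (φ p).1.1 2 = r * p.1.1 2 := by
  obtain ⟨r, hr, h1⟩ := h p
  refine ⟨r, hr, h1, ?_⟩
  have h2 := ip_toR22_self (φ p)
  rw [h1, ip_smul_left, ip_smul_right, ip_mulVec hA, ip_toR22_self] at h2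
  have h3 : (φ p).1.1 2 ^ 2 = (r * p.1.1 2) ^ 2 := by linarith
  exact (sq_eq_sq₀ (φ p).1.2.2 (mul_nonneg hr.le p.1.2.2)).mp h3

lemma IsLift.mem_adsTilde (hA : A ∈ O22) (h : IsLift A φ) {p : Cyl} (hp : p ∈ adsTilde) :
    φ p ∈ adsTilde := by
  obtain ⟨r, hr, -, h2⟩ := h.spec hA p
  show 0 < (φ p).1.1 2
  rw [h2]
  exact mul_pos hr hp

lemma IsLift.mem_einHat (hA : A ∈ O22) (h : IsLift A φ) {p : Cyl} (hp : p ∈ einHat) :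
    φ p ∈ einHat := by
  obtain ⟨r, hr, -, h2⟩ := h.spec hA p
  show (φ p).1.1 2 = 0
  rw [h2, show p.1.1 2 = 0 from hp, mul_zero]

lemma IsLift.inv (h : IsLift A φ) : IsLift A⁻¹ φ⁻¹ := by
  intro p
  obtain ⟨r, hr, h1⟩ := h (φ⁻¹ p)
  refine ⟨r⁻¹, inv_pos.mpr hr, ?_⟩
  have h3 : φ (φ⁻¹ p) = p := φ.apply_symm_apply p
  have h4 : (A⁻¹).1 * A.1 = 1 := by rw [← Units.val_mul]; simp
  rw [h3] at h1
  rw [h1, Matrix.mulVec_smul, Matrix.mulVec_mulVec, h4, Matrix.one_mulVec, smul_smul,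
    inv_mul_cancel₀ hr.ne', one_smul]

/-- Lifts preserve the relation of being spacelike to a boundary point.  Along the arc from `p` to
`q` this relation can be read off the bilinear form, as long as the time difference of the images
has not reached `π`, where it cannot hold. -/
lemma IsLift.abs_sub_lt (hA : A ∈ O22) (h : IsLift A φ) {p q : Cyl} (hp : p ∈ einHat)
    (hpq : |q.2 - p.2| < sphDist q.1 p.1) : |(φ q).2 - (φ p).2| < sphDist (φ q).1 (φ p).1 := by
  obtain ⟨c, hc, hc0, hc1, hcn, hci, -, hpos, -, -⟩ := exists_geodesic p.1 q.1
  set d := sphDist p.1 q.1 with hd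
  have hd0 : 0 ≤ d := sphDist_nonneg _ _
  have hdpi : d ≤ Real.pi := sphDist_le_pi _ _
  rw [sphDist_comm] at hpq
  let Q : Icc (0 : ℝ) 1 → Cyl := fun s => (⟨c s, hcn s, hpos s s.2⟩, p.2 + s * (q.2 - p.2))
  have hQ : Continuous Q := by
    have := hc.continuous
    refine Continuous.prodMk (Continuous.subtype_mk (this.comp continuous_subtype_val) _) ?_
    fun_prop
  have hQ0 : Q ⟨0, by simp⟩ = p := by
    refine Prod.ext (Subtype.ext hc0) ?_
    simp [Q]
  have hQ1 : Q ⟨1, by simp⟩ = q := by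
    refine Prod.ext (Subtype.ext hc1) ?_
    simp [Q]
  have hφp : (φ p).1.1 2 = 0 := h.mem_einHat hA hp
  have hcos : ∀ s : Icc (0 : ℝ) 1, 0 < s.1 →
      Real.cos (sphDist (φ p).1 (φ (Q s)).1) < Real.cos ((φ (Q s)).2 - (φ p).2) := by
    intro s hs
    have hdist : sphDist p.1 (Q s).1 = s * d := by
      have h1 : Real.cos (sphDist p.1 (Q s).1) = Real.cos (s * d) := by
        rw [← hci s, cos_sphDist, inner_coord]
      exact Real.injOn_cos ⟨sphDist_nonneg _ _, sphDist_le_pi _ _⟩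
        ⟨mul_nonneg s.2.1 hd0, (mul_le_of_le_one_left hd0 s.2.2).trans hdpi⟩ h1
    have hneg : ip (toR22 p) (toR22 (Q s)) < 0 := by
      have e : p.2 - (Q s).2 = -(s * (q.2 - p.2)) := by simp [Q]
      rw [ip_toR22, show p.1.1 2 = 0 from hp, zero_mul, sub_zero, sub_neg, hdist, e, Real.cos_neg,
        ← Real.cos_abs (s.1 * (q.2 - p.2))]
      refine Real.cos_lt_cos_of_nonneg_of_le_pi (abs_nonneg _)
        ((mul_le_of_le_one_left hd0 s.2.2).trans hdpi) ?_
      rw [abs_mul, abs_of_pos hs]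
      exact mul_lt_mul_of_pos_left hpq hs
    obtain ⟨r, hr, h1, -⟩ := h.spec hA p
    obtain ⟨r', hr', h1', -⟩ := h.spec hA (Q s)
    have h2 := ip_toR22 (φ p) (φ (Q s))
    rw [h1, h1', ip_smul_left, ip_smul_right, ip_mulVec hA, hφp, zero_mul, sub_zero] at h2
    have h3 := mul_neg_of_pos_of_neg hr (mul_neg_of_pos_of_neg hr' hneg)
    rw [← neg_sub (φ (Q s)).2, Real.cos_neg] at h2
    linarith
  have hlt : |(φ q).2 - (φ p).2| < Real.pi := by
    by_contra hge
    have hcont : Continuous fun s => |(φ (Q s)).2 - (φ p).2| := by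
      have := (continuous_snd.comp (φ.continuous.comp hQ))
      exact (this.sub continuous_const).abs
    obtain ⟨s, hs⟩ := mem_range_of_exists_le_of_exists_ge hcont
      (c := Real.pi) ⟨⟨0, by simp⟩, by rw [hQ0]; simp [Real.pi_pos.le]⟩
      ⟨⟨1, by simp⟩, by rw [hQ1]; exact not_lt.mp hge⟩
    simp only at hs
    rcases s.2.1.eq_or_lt with h0 | h0
    · have : s = ⟨0, by simp⟩ := Subtype.ext h0.symm
      rw [this, hQ0] at hs
      simp at hs
      exact Real.pi_ne_zero hs.symm
    · have := hcos s h0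
      rw [← Real.cos_abs ((φ (Q s)).2 - _), hs, Real.cos_pi] at this
      linarith [Real.neg_one_le_cos (sphDist (φ p).1 (φ (Q s)).1)]
  have h1 := hcos ⟨1, by simp⟩ one_pos
  rw [hQ1, ← Real.cos_abs ((φ q).2 - _)] at h1
  rw [sphDist_comm]
  by_contra hge
  have := Real.cos_le_cos_of_nonneg_of_le_pi (sphDist_nonneg (φ p).1 (φ q).1) hlt.le (not_lt.mp hge)
  linarith

lemma preserves_of_forall_mem {S : Set Cyl} (h : ∀ γ ∈ Γ, ∀ p ∈ S, γ p ∈ S) : Preserves Γ S := by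
  intro γ hγ
  refine Subset.antisymm (by rintro _ ⟨p, hp, rfl⟩; exact h γ hγ p hp) fun p hp => ?_
  exact ⟨γ⁻¹ p, h _ (inv_mem hγ) p hp, γ.apply_symm_apply p⟩

lemma Preserves.mem {S : Set Cyl} (h : Preserves Γ S) {γ : Cyl ≃ₜ Cyl} (hγ : γ ∈ Γ) {p : Cyl}
    (hp : p ∈ S) : γ p ∈ S := h γ hγ ▸ mem_image_of_mem γ hp

lemma mem_invisible_of_mem (hL : L ⊆ einHat) (hΓ : Γ ≤ SO22Hat) (hinv : Preserves Γ L)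
    {γ : Cyl ≃ₜ Cyl} (hγ : γ ∈ Γ) {p : Cyl} (hp : p ∈ invisible L) : γ p ∈ invisible L := by
  intro q hq
  obtain ⟨A, hA, hlift⟩ := hΓ hγ
  have h1 : γ⁻¹ q ∈ L := hinv.mem (inv_mem hγ) hq
  have h2 := hlift.abs_sub_lt (SO22_le_O22 hA) (hL h1) (hp _ h1)
  rwa [show γ (γ⁻¹ q) = q from γ.apply_symm_apply q] at h2

lemma preserves_adsTilde (hΓ : Γ ≤ SO22Hat) : Preserves Γ adsTilde :=
  preserves_of_forall_mem fun _ hγ _ hp =>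
    let ⟨_, hA, hlift⟩ := hΓ hγ
    hlift.mem_adsTilde (SO22_le_O22 hA) hp

lemma preserves_einHat (hΓ : Γ ≤ SO22Hat) : Preserves Γ einHat :=
  preserves_of_forall_mem fun _ hγ _ hp =>
    let ⟨_, hA, hlift⟩ := hΓ hγ
    hlift.mem_einHat (SO22_le_O22 hA) hp

lemma preserves_invisible (hL : L ⊆ einHat) (hΓ : Γ ≤ SO22Hat) (hinv : Preserves Γ L) :
    Preserves Γ (invisible L) :=
  preserves_of_forall_mem fun _ hγ _ hp => mem_invisible_of_mem hL hΓ hinv hγ hp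

lemma Preserves.inter {S T : Set Cyl} (hS : Preserves Γ S) (hT : Preserves Γ T) :
    Preserves Γ (S ∩ T) :=
  preserves_of_forall_mem fun _ hγ _ hp => ⟨hS.mem hγ hp.1, hT.mem hγ hp.2⟩

/-! ### Discreteness in terms of matrices -/

instance : PreconnectedSpace Hemisphere := by
  refine ⟨isPreconnected_of_forall_pair fun x _ y _ => ?_⟩
  obtain ⟨c, hc, hc0, hc1, hcn, -, -, hpos, -, -⟩ := exists_geodesic x y
  let Q : Icc (0 : ℝ) 1 → Hemisphere := fun s => ⟨c s, hcn s, hpos s s.2⟩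
  have hQ : Continuous Q := Continuous.subtype_mk (hc.continuous.comp continuous_subtype_val) _
  exact ⟨range Q, subset_univ _, ⟨⟨0, by simp⟩, Subtype.ext hc0⟩, ⟨⟨1, by simp⟩, Subtype.ext hc1⟩,
    isPreconnected_range hQ⟩

lemma abs_mulVec_sub_le (C : Matrix (Fin 4) (Fin 4) ℝ) (p : Cyl) (i : Fin 4) :
    |C.mulVec (toR22 p) i - toR22 p i| ≤ ∑ j, |(C - 1) i j| := by
  have h : C.mulVec (toR22 p) i - toR22 p i = ∑ j, (C - 1) i j * toR22 p j := by
    have : (C - 1).mulVec (toR22 p) i = C.mulVec (toR22 p) i - toR22 p i := by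
      rw [Matrix.sub_mulVec, Matrix.one_mulVec]; rfl
    rw [← this]; rfl
  rw [h]
  refine (Finset.abs_sum_le_sum_abs _ _).trans (Finset.sum_le_sum fun j _ => ?_)
  rw [abs_mul]
  exact mul_le_of_le_one_right (abs_nonneg _) (abs_toR22_le p j)

/-- Homeomorphisms that preserve a compact set of the cylinder and lift matrices converging to the
identity converge to the identity.  That they move no point by a nontrivial deck transformation
follows from the invariance of the compact set. -/
lemma tendsto_of_tendsto_one (hc : IsCompact L) (hne : L.Nonempty) {η : ℕ → Cyl ≃ₜ Cyl}
    (hη : ∀ k, ∀ p ∈ L, η k p ∈ L) {C : ℕ → Matrix (Fin 4) (Fin 4) ℝ}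
    (hlift : ∀ k p, ∃ r : ℝ, 0 < r ∧ toR22 (η k p) = r • (C k).mulVec (toR22 p))
    (hC : Tendsto C atTop (𝓝 1)) (p₀ : Cyl) :
    Tendsto (fun y : ℕ × Cyl => η y.1 y.2) (atTop ×ˢ 𝓝 p₀) (𝓝 p₀) := by
  have hsmall : ∀ᶠ k in atTop, ∀ i, ∑ j, |(C k - 1) i j| < 1 / 4 := by
    rw [eventually_all]
    intro i
    have h0 : Tendsto (fun k => ∑ j, |(C k - 1) i j|) atTop
        (𝓝 (∑ j, |(1 - 1 : Matrix (Fin 4) (Fin 4) ℝ) i j|)) := by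
      refine tendsto_finsetSum _ fun j _ => Tendsto.abs ?_
      have h1 : Continuous fun M : Matrix (Fin 4) (Fin 4) ℝ => (M - 1) i j := by fun_prop
      exact (h1.tendsto 1).comp hC
    simp only [sub_self, Matrix.zero_apply, abs_zero, Finset.sum_const_zero] at h0
    exact h0.eventually_lt_const (by norm_num)
  have htime : ∀ᶠ k in atTop, ∀ p : Cyl, |(η k p).2 - p.2| < Real.pi / 2 := by
    filter_upwards [hsmall] with k hk p
    have hcos : ∀ p : Cyl, 0 < Real.cos ((η k p).2 - p.2) := by
      intro p
      obtain ⟨r, hr, h1⟩ := hlift k p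
      have e0 := (abs_mulVec_sub_le (C k) p 0).trans_lt (hk 0)
      have e1 := (abs_mulVec_sub_le (C k) p 1).trans_lt (hk 1)
      have b0 := abs_le.mp (abs_toR22_le p 0)
      have b1 := abs_le.mp (abs_toR22_le p 1)
      have hsq := toR22_zero_sq_add p
      have hc : Real.cos ((η k p).2 - p.2) = toR22 (η k p) 0 * toR22 p 0 +
          toR22 (η k p) 1 * toR22 p 1 := by rw [Real.cos_sub]; rfl
      rw [hc, h1]
      simp only [Pi.smul_apply, smul_eq_mul]
      set u := (C k).mulVec (toR22 p)
      set v := toR22 p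
      have a0 : |(u 0 - v 0) * v 0| ≤ 1 / 4 := by
        rw [abs_mul]
        exact (mul_le_of_le_one_right (abs_nonneg _) (abs_toR22_le p 0)).trans e0.le
      have a1 : |(u 1 - v 1) * v 1| ≤ 1 / 4 := by
        rw [abs_mul]
        exact (mul_le_of_le_one_right (abs_nonneg _) (abs_toR22_le p 1)).trans e1.le
      have : 0 < u 0 * v 0 + u 1 * v 1 := by
        have := (abs_le.mp a0).1
        have := (abs_le.mp a1).1
        nlinarith
      have := mul_pos hr this
      linarith
    have hcont : Continuous fun p : Cyl => (η k p).2 - p.2 :=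
      (continuous_snd.comp (η k).continuous).sub continuous_snd
    -- the time displacement vanishes somewhere, as it has both signs on the invariant set `L`, and it
    -- never reaches `π / 2`, where its cosine would vanish
    obtain ⟨a, ha, hamax⟩ := hc.exists_isMaxOn hne continuous_snd.continuousOn
    obtain ⟨b, hb, hbmin⟩ := hc.exists_isMinOn hne continuous_snd.continuousOn
    obtain ⟨z, hz⟩ := mem_range_of_exists_le_of_exists_ge hcont (c := 0)
      ⟨a, sub_nonpos.mpr (hamax (hη k a ha))⟩ ⟨b, sub_nonneg.mpr (hbmin (hη k b hb))⟩
    by_contra hge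
    obtain ⟨q, hq⟩ := mem_range_of_exists_le_of_exists_ge hcont.abs (c := Real.pi / 2)
      ⟨z, by simp only at hz; rw [hz, abs_zero]; positivity⟩ ⟨p, not_lt.mp hge⟩
    have := hcos q
    simp only at hq
    rw [← Real.cos_abs, hq, Real.cos_pi_div_two] at this
    exact lt_irrefl _ this
  have hfst : Tendsto (fun y : ℕ × Cyl => C y.1) (atTop ×ˢ 𝓝 p₀) (𝓝 1) := hC.comp tendsto_fst
  have hsnd : Tendsto (fun y : ℕ × Cyl => toR22 y.2) (atTop ×ˢ 𝓝 p₀) (𝓝 (toR22 p₀)) :=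
    (continuous_toR22.tendsto p₀).comp tendsto_snd
  have hmul : Tendsto (fun y : ℕ × Cyl => (C y.1).mulVec (toR22 y.2)) (atTop ×ˢ 𝓝 p₀)
      (𝓝 (toR22 p₀)) := by
    have h1 : Continuous fun x : Matrix (Fin 4) (Fin 4) ℝ × (Fin 4 → ℝ) => x.1.mulVec x.2 := by
      fun_prop
    have := (h1.tendsto (1, toR22 p₀)).comp (hfst.prodMk_nhds hsnd)
    simpa [Function.comp_def] using this
  have hN : Tendsto (fun y : ℕ × Cyl => (√((C y.1).mulVec (toR22 y.2) 0 ^ 2 +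
      (C y.1).mulVec (toR22 y.2) 1 ^ 2))⁻¹ • (C y.1).mulVec (toR22 y.2)) (atTop ×ˢ 𝓝 p₀)
      (𝓝 (toR22 p₀)) := by
    have h0 := tendsto_pi_nhds.mp hmul 0
    have h1 := tendsto_pi_nhds.mp hmul 1
    have h2 := ((h0.pow 2).add (h1.pow 2)).sqrt
    rw [toR22_zero_sq_add, Real.sqrt_one] at h2
    have := (h2.inv₀ one_ne_zero).smul hmul
    simpa using this
  refine tendsto_of_toR22 (hN.congr fun y => ?_) ?_
  · obtain ⟨r, hr, h1⟩ := hlift y.1 y.2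
    set u := (C y.1).mulVec (toR22 y.2)
    have h2 := toR22_zero_sq_add (η y.1 y.2)
    rw [h1] at h2 ⊢
    simp only [Pi.smul_apply, smul_eq_mul] at h2
    have h3 : u 0 ^ 2 + u 1 ^ 2 = (r⁻¹) ^ 2 := by
      field_simp
      linarith
    rw [h3, Real.sqrt_sq (inv_nonneg.mpr hr.le), inv_inv]
  · have h1 : ∀ᶠ y : ℕ × Cyl in atTop ×ˢ 𝓝 p₀, |(η y.1 y.2).2 - y.2.2| < Real.pi / 2 :=
      (tendsto_fst.eventually htime).mono fun y hy => hy y.2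
    have h2 : ∀ᶠ y : ℕ × Cyl in atTop ×ˢ 𝓝 p₀, |y.2.2 - p₀.2| < Real.pi / 2 := by
      have h3 : Tendsto (fun y : ℕ × Cyl => |y.2.2 - p₀.2|) (atTop ×ˢ 𝓝 p₀) (𝓝 0) := by
        have : Continuous fun q : Cyl => |q.2 - p₀.2| := by fun_prop
        have := (this.tendsto p₀).comp (tendsto_snd (f := (atTop : Filter ℕ)) (g := 𝓝 p₀))
        simpa [Function.comp_def] using this
      exact h3.eventually_lt_const (by positivity)
    filter_upwards [h1, h2] with y hy1 hy2
    have := abs_sub_le (η y.1 y.2).2 y.2.2 p₀.2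
    linarith

/-- A sequence of distinct elements of a discrete group preserving a compact set lifts an unbounded
sequence of matrices. -/
lemma exists_entry_gt (hc : IsCompact L) (hne : L.Nonempty) (hdisc : IsDiscreteGroup Γ)
    (hinv : Preserves Γ L) {γ : ℕ → Cyl ≃ₜ Cyl} (hγ : ∀ n, γ n ∈ Γ) (hinj : Function.Injective γ)
    {A : ℕ → GL (Fin 4) ℝ} (hA : ∀ n, A n ∈ O22) (hlift : ∀ n, IsLift (A n) (γ n)) (M : ℝ) :
    ∃ n i j, M < |(A n).1 i j| := by
  by_contra! hM
  have hK : IsCompact (univ.pi fun _ => univ.pi fun _ => Icc (-M) M :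
      Set (Fin 4 → Fin 4 → ℝ)) := isCompact_univ_pi fun _ => isCompact_univ_pi fun _ => isCompact_Icc
  obtain ⟨A₀, -, ψ, hψ, hlim⟩ := hK.tendsto_subseq (x := fun n i j => (A n).1 i j)
    fun n i _ j _ => abs_le.mp (hM n i j)
  let B : ℕ → Matrix (Fin 4) (Fin 4) ℝ := fun k => (A (ψ k)).1
  let B₀ : Matrix (Fin 4) (Fin 4) ℝ := A₀
  have hB : Tendsto B atTop (𝓝 B₀) := hlim
  have hadj : Tendsto (fun k => adj (B k)) atTop (𝓝 (adj B₀)) :=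
    (continuous_adj.tendsto B₀).comp hB
  have hone : adj B₀ * B₀ = 1 := by
    refine tendsto_nhds_unique (hadj.mul hB) ?_
    refine tendsto_const_nhds.congr fun k => ?_
    exact (adj_mul_self (hA (ψ k))).symm
  let η : ℕ → Cyl ≃ₜ Cyl := fun k => (γ (ψ k))⁻¹ * γ (ψ (k + 1))
  have hηΓ : ∀ k, η k ∈ Γ := fun k => mul_mem (inv_mem (hγ _)) (hγ _)
  -- the matrices `Aₖ⁻¹ Aₖ₊₁`, where `Aₖ⁻¹` is the adjoint of `Aₖ`
  have hC : Tendsto (fun k => adj (B k) * B (k + 1)) atTop (𝓝 1) := by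
    rw [← hone]
    exact hadj.mul (hB.comp (tendsto_add_atTop_nat 1))
  have hηlift : ∀ k p, ∃ r : ℝ, 0 < r ∧
      toR22 (η k p) = r • (adj (B k) * B (k + 1)).mulVec (toR22 p) := by
    intro k p
    obtain ⟨r, hr, h1⟩ := hlift (ψ (k + 1)) p
    obtain ⟨s, hs, h2⟩ := (hlift (ψ k)).inv (γ (ψ (k + 1)) p)
    refine ⟨s * r, mul_pos hs hr, ?_⟩
    show toR22 ((γ (ψ k))⁻¹ (γ (ψ (k + 1)) p)) = _
    rw [h2, h1, inv_eq_adj (hA _), Matrix.mulVec_smul, Matrix.mulVec_mulVec, smul_smul]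
  have hlim' : Tendsto (fun k => (η k : C(Cyl, Cyl))) atTop (𝓝 ((1 : Cyl ≃ₜ Cyl) : C(Cyl, Cyl))) := by
    rw [ContinuousMap.tendsto_iff_tendstoLocallyUniformly,
      tendstoLocallyUniformly_iff_forall_tendsto]
    intro p
    have h1 := tendsto_of_tendsto_one hc hne (fun k p hp => hinv.mem (hηΓ k) hp) hηlift hC p
    have h2 : Tendsto (fun y : ℕ × Cyl => y.2) (atTop ×ˢ 𝓝 p) (𝓝 p) := tendsto_snd
    exact (h2.prodMk_nhds h1).mono_right (nhds_prod_eq (x := p) (y := p) ▸ nhds_le_uniformity p)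
  have hpure : ∀ᶠ k in atTop, η k = 1 := by
    unfold IsDiscreteGroup at hdisc
    have hmem : ∀ g ∈ Γ, (g : C(Cyl, Cyl)) ∈
        (fun φ : Cyl ≃ₜ Cyl => (φ : C(Cyl, Cyl))) '' (Γ : Set (Cyl ≃ₜ Cyl)) :=
      fun g hg => ⟨g, hg, rfl⟩
    have h1 : Tendsto (fun k => (⟨(η k : C(Cyl, Cyl)), hmem _ (hηΓ k)⟩ :
        ((fun φ : Cyl ≃ₜ Cyl => (φ : C(Cyl, Cyl))) '' (Γ : Set (Cyl ≃ₜ Cyl)))))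
        atTop (𝓝 ⟨((1 : Cyl ≃ₜ Cyl) : C(Cyl, Cyl)), hmem _ (one_mem Γ)⟩) := by
      rw [tendsto_subtype_rng]
      exact hlim'
    rw [nhds_discrete, tendsto_pure] at h1
    filter_upwards [h1] with k hk
    ext1 p
    exact congrArg (fun f : C(Cyl, Cyl) => f p) (Subtype.ext_iff.mp hk)
  obtain ⟨k, hk⟩ := hpure.exists
  have h1 : γ (ψ k) = γ (ψ (k + 1)) := by
    have : (γ (ψ k))⁻¹ * γ (ψ (k + 1)) = 1 := hk
    exact (inv_mul_eq_one.mp this)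
  have := hψ.injective (hinj h1)
  omega

end

section

/-! ### Limits of normalized matrices -/

variable {L : Set Cyl} {Γ : Subgroup (Cyl ≃ₜ Cyl)}

/-- The sequence `γ n` of lifts preserving `L` diverges, and the matrices that it lifts converge
projectively to the singular matrix `B`: after division by the scalars `s n`, which go to infinity,
they converge to `B ≠ 0`. -/
structure DivergesTo (L : Set Cyl) (γ : ℕ → Cyl ≃ₜ Cyl) (A : ℕ → GL (Fin 4) ℝ) (s : ℕ → ℝ)
    (B : Matrix (Fin 4) (Fin 4) ℝ) : Prop where
  mem : ∀ n, A n ∈ O22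
  lift : ∀ n, IsLift (A n) (γ n)
  map : ∀ n, ∀ y ∈ L, γ n y ∈ L
  map_inv : ∀ n, ∀ y ∈ L, (γ n)⁻¹ y ∈ L
  pos : ∀ n, 0 < s n
  tendsto_atTop : Tendsto s atTop atTop
  ne_zero : B ≠ 0
  tendsto : Tendsto (fun n => (s n)⁻¹ • (A n).1) atTop (𝓝 B)

lemma exists_divergesTo (hc : IsCompact L) (hne : L.Nonempty) (hΓ : Γ ≤ SO22Hat)
    (hdisc : IsDiscreteGroup Γ) (hinv : Preserves Γ L) {γ : ℕ → Cyl ≃ₜ Cyl} (hγ : ∀ n, γ n ∈ Γ)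
    (hinj : Function.Injective γ) : ∃ ψ : ℕ → ℕ, StrictMono ψ ∧ ∃ A s B,
      DivergesTo L (γ ∘ ψ) A s B := by
  choose A hA hlift using fun n => hΓ (hγ n)
  have hA' : ∀ n, A n ∈ O22 := fun n => SO22_le_O22 (hA n)
  -- the norm by which the matrices are divided
  let N : Matrix (Fin 4) (Fin 4) ℝ → ℝ := fun M => ∑ i, ∑ j, |M i j|
  have hle : ∀ M i j, |M i j| ≤ N M := fun M i j =>
    (Finset.single_le_sum (f := fun j => |M i j|) (fun _ _ => abs_nonneg _)
      (Finset.mem_univ j)).trans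
      (Finset.single_le_sum (f := fun i => ∑ j, |M i j|)
        (fun _ _ => Finset.sum_nonneg fun _ _ => abs_nonneg _) (Finset.mem_univ i))
  have hNcont : Continuous N := by
    refine continuous_finsetSum _ fun i _ => continuous_finsetSum _ fun j _ => Continuous.abs ?_
    fun_prop
  have hfreq : ∀ m : ℕ, ∃ᶠ k in atTop, (m : ℝ) < N (A k).1 := by
    intro m
    rw [frequently_atTop]
    intro a
    obtain ⟨n, i, j, h⟩ := exists_entry_gt hc hne hdisc hinv (γ := fun n => γ (n + a))
      (fun n => hγ _) (fun x y h => by simpa using hinj h) (A := fun n => A (n + a))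
      (fun n => hA' _) (fun n => hlift _) m
    exact ⟨n + a, by omega, h.trans_le (hle _ i j)⟩
  obtain ⟨ψ, hψ, hψN⟩ := extraction_forall_of_frequently hfreq
  have hpos : ∀ n, 0 < N (A (ψ n)).1 := fun n => (Nat.cast_nonneg n).trans_lt (hψN n)
  let M : ℕ → Matrix (Fin 4) (Fin 4) ℝ := fun n => (N (A (ψ n)).1)⁻¹ • (A (ψ n)).1
  have hM : ∀ n i j, |M n i j| ≤ 1 := by
    intro n i j
    simp only [M, Matrix.smul_apply, smul_eq_mul, abs_mul, abs_inv, abs_of_pos (hpos n)]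
    rw [inv_mul_le_iff₀ (hpos n), mul_one]
    exact hle _ i j
  have hK : IsCompact (univ.pi fun _ => univ.pi fun _ => Icc (-1) 1 :
      Set (Fin 4 → Fin 4 → ℝ)) := isCompact_univ_pi fun _ => isCompact_univ_pi fun _ => isCompact_Icc
  obtain ⟨B, -, χ, hχ, hlim⟩ := hK.tendsto_subseq (x := fun n i j => M n i j)
    fun n i _ j _ => abs_le.mp (hM n i j)
  let B' : Matrix (Fin 4) (Fin 4) ℝ := B
  have hlim' : Tendsto (M ∘ χ) atTop (𝓝 B') := hlim
  refine ⟨ψ ∘ χ, hψ.comp hχ, fun n => A (ψ (χ n)), fun n => N (A (ψ (χ n))).1, B', ?_⟩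
  refine ⟨fun n => hA' _, fun n => hlift _, fun n y hy => hinv.mem (hγ _) hy,
    fun n y hy => hinv.mem (inv_mem (hγ _)) hy, fun n => hpos _, ?_, ?_, hlim'⟩
  · have h1 : Tendsto (fun n => N (A (ψ n)).1) atTop atTop :=
      tendsto_atTop_mono (fun n => (hψN n).le) tendsto_natCast_atTop_atTop
    exact h1.comp hχ.tendsto_atTop
  · have h1 : N B' = 1 := by
      refine tendsto_nhds_unique ((hNcont.tendsto B').comp hlim') ?_
      refine tendsto_const_nhds.congr fun n => ?_
      simp only [N, M, Function.comp, Matrix.smul_apply, smul_eq_mul, abs_mul, abs_inv,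
        ← Finset.mul_sum]
      rw [abs_of_pos]
      · exact (inv_mul_cancel₀ (hpos _).ne').symm
      · exact hpos _
    intro h0
    rw [h0] at h1
    simp [N] at h1

/-- If positive multiples of convergent vectors converge, then so do the directions. -/
lemma exists_nonneg_smul_eq {u w : ℕ → Fin 4 → ℝ} {u₀ w₀ : Fin 4 → ℝ} {c : ℕ → ℝ}
    (hc : ∀ n, 0 < c n) (hcw : ∀ n, w n = c n • u n) (hu : Tendsto u atTop (𝓝 u₀))
    (hw : Tendsto w atTop (𝓝 w₀)) (hu₀ : u₀ ≠ 0) : ∃ l : ℝ, 0 ≤ l ∧ w₀ = l • u₀ := by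
  have hdot : Continuous fun x : (Fin 4 → ℝ) × (Fin 4 → ℝ) => x.1 ⬝ᵥ x.2 := by fun_prop
  have h1 : Tendsto (fun n => w n ⬝ᵥ u n) atTop (𝓝 (w₀ ⬝ᵥ u₀)) :=
    (hdot.tendsto (w₀, u₀)).comp (hw.prodMk_nhds hu)
  have h2 : Tendsto (fun n => u n ⬝ᵥ u n) atTop (𝓝 (u₀ ⬝ᵥ u₀)) :=
    (hdot.tendsto (u₀, u₀)).comp (hu.prodMk_nhds hu)
  have h0 : u₀ ⬝ᵥ u₀ ≠ 0 := fun h => hu₀ (dotProduct_self_eq_zero.mp h)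
  have h3 : Tendsto c atTop (𝓝 (w₀ ⬝ᵥ u₀ / u₀ ⬝ᵥ u₀)) := by
    refine (h1.div h2 h0).congr' ?_
    filter_upwards [h2.eventually_ne h0] with n hn
    rw [Pi.div_apply, hcw, smul_dotProduct, smul_eq_mul, mul_div_cancel_right₀ _ hn]
  refine ⟨_, ge_of_tendsto' h3 fun n => (hc n).le, ?_⟩
  refine tendsto_nhds_unique hw ?_
  exact (h3.smul hu).congr fun n => (hcw n).symm

namespace DivergesTo

variable {γ : ℕ → Cyl ≃ₜ Cyl} {A : ℕ → GL (Fin 4) ℝ} {s : ℕ → ℝ} {B : Matrix (Fin 4) (Fin 4) ℝ}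

lemma comp (h : DivergesTo L γ A s B) {χ : ℕ → ℕ} (hχ : StrictMono χ) :
    DivergesTo L (γ ∘ χ) (A ∘ χ) (s ∘ χ) B :=
  ⟨fun _ => h.mem _, fun _ => h.lift _, fun _ => h.map _, fun _ => h.map_inv _, fun _ => h.pos _,
    h.tendsto_atTop.comp hχ.tendsto_atTop, h.ne_zero, h.tendsto.comp hχ.tendsto_atTop⟩

lemma symm (h : DivergesTo L γ A s B) :
    DivergesTo L (fun n => (γ n)⁻¹) (fun n => (A n)⁻¹) s (adj B) := by
  refine ⟨fun n => inv_mem (h.mem n), fun n => (h.lift n).inv, h.map_inv,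
    fun n y hy => by rw [inv_inv]; exact h.map n y hy, h.pos, h.tendsto_atTop, fun h0 => h.ne_zero ?_,
    ?_⟩
  · rw [← adj_adj B, h0]
    simp [adj]
  · refine ((continuous_adj.tendsto B).comp h.tendsto).congr fun n => ?_
    rw [Function.comp, adj_smul, inv_eq_adj (h.mem n)]

lemma tendsto_mulVec (h : DivergesTo L γ A s B) {v : ℕ → Fin 4 → ℝ} {v₀ : Fin 4 → ℝ}
    (hv : Tendsto v atTop (𝓝 v₀)) :
    Tendsto (fun n => (s n)⁻¹ • (A n).1.mulVec (v n)) atTop (𝓝 (B.mulVec v₀)) := by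
  have h1 : Continuous fun x : Matrix (Fin 4) (Fin 4) ℝ × (Fin 4 → ℝ) => x.1.mulVec x.2 := by
    fun_prop
  refine ((h1.tendsto (B, v₀)).comp (h.tendsto.prodMk_nhds hv)).congr fun n => ?_
  simp [Function.comp, Matrix.smul_mulVec]

/-- The image of the limit is totally isotropic. -/
lemma ip_mulVec_mulVec (h : DivergesTo L γ A s B) (u w : Fin 4 → ℝ) :
    ip (B.mulVec u) (B.mulVec w) = 0 := by
  refine tendsto_nhds_unique (tendsto_ip (h.tendsto_mulVec tendsto_const_nhds)
    (h.tendsto_mulVec tendsto_const_nhds)) ?_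
  have h1 : Tendsto (fun n => (s n)⁻¹ * ((s n)⁻¹ * ip u w)) atTop (𝓝 0) := by
    have h2 := h.tendsto_atTop.inv_tendsto_atTop
    have := h2.mul (h2.mul_const (ip u w))
    simpa using this
  refine h1.congr fun n => ?_
  rw [ip_smul_left, ip_smul_right, ip_mulVec (h.mem n)]

/-- A nonelementary invariant set is not contained in the kernel of the limit. -/
lemma exists_mulVec_ne_zero (h : DivergesTo L γ A s B) (hL : IsLimitSet L) :
    ∃ y ∈ L, B.mulVec (toR22 y) ≠ 0 := by
  by_contra! hall
  obtain ⟨w, hw⟩ : ∃ w, (adj B).mulVec w ≠ 0 := by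
    by_contra! h0
    apply h.symm.ne_zero
    ext i j
    have := congrFun (h0 (Pi.single j 1)) i
    simpa using this
  obtain ⟨y, hy, hne⟩ := hL.exists_ip_ne_zero hw (h.symm.ip_mulVec_mulVec w w)
  rw [← ip_adj, hall y hy] at hne
  simp [ip] at hne

/-- If the images under `γ n` of points converging to `p₀` have a limit, then it is in the direction of
`B p₀`. -/
lemma exists_nonneg_smul (h : DivergesTo L γ A s B) {p : ℕ → Cyl} {p₀ : Cyl} {v : Fin 4 → ℝ}
    (hp : Tendsto p atTop (𝓝 p₀)) (hq : Tendsto (fun n => toR22 (γ n (p n))) atTop (𝓝 v))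
    (hv : v ≠ 0) : ∃ l : ℝ, 0 ≤ l ∧ B.mulVec (toR22 p₀) = l • v := by
  choose r hr hr' using fun n => h.lift n (p n)
  refine exists_nonneg_smul_eq (c := fun n => (s n)⁻¹ * (r n)⁻¹)
    (fun n => mul_pos (inv_pos.mpr (h.pos n)) (inv_pos.mpr (hr n))) (fun n => ?_) hq
    (h.tendsto_mulVec ((continuous_toR22.tendsto p₀).comp hp)) hv
  simp only [Function.comp, hr', smul_smul, mul_assoc, inv_mul_cancel₀ (hr n).ne', mul_one]

/-- The limit matrix sends the cone over `L` into itself, up to its kernel. -/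
lemma exists_mem (h : DivergesTo L γ A s B) (hc : IsCompact L) {y : Cyl} (hy : y ∈ L) :
    ∃ z ∈ L, ∃ l : ℝ, 0 ≤ l ∧ B.mulVec (toR22 y) = l • toR22 z := by
  obtain ⟨z, hz, χ, hχ, hlim⟩ := hc.tendsto_subseq (x := fun n => γ n y) fun n => h.map n y hy
  obtain ⟨l, hl, hl'⟩ := (h.comp hχ).exists_nonneg_smul (p := fun _ => y) tendsto_const_nhds
    ((continuous_toR22.tendsto z).comp hlim) (toR22_ne_zero z)
  exact ⟨z, hz, l, hl, hl'⟩

lemma ip_mulVec_nonpos (h : DivergesTo L γ A s B) (hL : IsLimitSet L) {p y : Cyl}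
    (hp : p ∈ invisible L) (hy : y ∈ L) : ip (toR22 p) (B.mulVec (toR22 y)) ≤ 0 := by
  obtain ⟨z, hz, l, hl, hl'⟩ := h.exists_mem hL.isCompact hy
  rw [hl', ip_smul_right]
  exact mul_nonpos_of_nonneg_of_nonpos hl (ip_neg_of_invisible hL hp hz).le

lemma ip_mulVec_neg (h : DivergesTo L γ A s B) (hL : IsLimitSet L) {p y : Cyl}
    (hp : p ∈ invisible L) (hy : y ∈ L) (hne : B.mulVec (toR22 y) ≠ 0) :
    ip (toR22 p) (B.mulVec (toR22 y)) < 0 := by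
  obtain ⟨z, hz, l, hl, hl'⟩ := h.exists_mem hL.isCompact hy
  rw [hl', ip_smul_right]
  refine mul_neg_of_pos_of_neg (hl.lt_of_ne' ?_) (ip_neg_of_invisible hL hp hz)
  rintro rfl
  rw [zero_smul] at hl'
  exact hne hl'

/-- The vectors of the invisible domain are not in the kernel of the limit, because the adjoint of the
limit sends some point of `L` to a point of `L`. -/
lemma mulVec_ne_zero (h : DivergesTo L γ A s B) (hL : IsLimitSet L) {p : Cyl}
    (hp : p ∈ invisible L) : B.mulVec (toR22 p) ≠ 0 := by
  obtain ⟨y, hy, hne⟩ := h.symm.exists_mulVec_ne_zero hL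
  have h1 := h.symm.ip_mulVec_neg hL hp hy hne
  rw [ip_comm, ← ip_adj] at h1
  intro h0
  simp [h0, ip] at h1

end DivergesTo

/-! ### Proper discontinuity -/

/-- A compact part of the invisible domain meets only finitely many of its translates.  Otherwise
the limit `B` of the normalized matrices sends some point of the compact set to the direction of
another one, which is not orthogonal to `L`; but the image of `B` is totally isotropic and contains
points of `L`. -/
lemma properlyDiscontinuous (hL : IsLimitSet L) (hΓ : Γ ≤ SO22Hat) (hdisc : IsDiscreteGroup Γ)
    (hinv : Preserves Γ L) {S : Set Cyl} (hS : S ⊆ invisible L) :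
    ActsProperlyDiscontinuously Γ S := by
  intro C hC hcomp
  by_contra hinf
  have hinf : {γ | γ ∈ Γ ∧ (γ '' C ∩ C).Nonempty}.Infinite := hinf
  let g := hinf.natEmbedding
  have hg : ∀ n, (g n).1 ∈ Γ := fun n => (g n).2.1
  obtain ⟨ψ, hψ, A, s, B, h⟩ := exists_divergesTo hL.isCompact hL.nonempty hΓ hdisc hinv hg
    (Subtype.val_injective.comp g.injective)
  have hex : ∀ n, ∃ p ∈ C, (g (ψ n)).1 p ∈ C := by
    intro n
    obtain ⟨_, ⟨p, hp, rfl⟩, hq⟩ := (g (ψ n)).2.2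
    exact ⟨p, hp, hq⟩
  choose p hp hq using hex
  obtain ⟨⟨p₀, q₀⟩, ⟨hp₀, hq₀⟩, χ, hχ, hlim⟩ := (hcomp.prod hcomp).tendsto_subseq
    (x := fun n => (p n, (g (ψ n)).1 (p n))) fun n => ⟨hp n, hq n⟩
  have hlp : Tendsto (fun n => p (χ n)) atTop (𝓝 p₀) :=
    (continuous_fst.tendsto _).comp hlim
  have hlq : Tendsto (fun n => (g (ψ (χ n))).1 (p (χ n))) atTop (𝓝 q₀) :=
    (continuous_snd.tendsto _).comp hlim
  obtain ⟨l, hl, hl'⟩ := (h.comp hχ).exists_nonneg_smul hlp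
    ((continuous_toR22.tendsto q₀).comp hlq) (toR22_ne_zero q₀)
  have hl0 : l ≠ 0 := by
    rintro rfl
    rw [zero_smul] at hl'
    exact h.mulVec_ne_zero hL (hS (hC hp₀)) hl'
  obtain ⟨y, hy, hne⟩ := h.exists_mulVec_ne_zero hL
  have h1 := h.ip_mulVec_neg hL (hS (hC hq₀)) hy hne
  have h2 := h.ip_mulVec_mulVec (toR22 p₀) (toR22 y)
  rw [hl', ip_smul_left] at h2
  exact h1.ne ((mul_eq_zero.mp h2).resolve_left hl0)

/-- Stabilizers of a properly discontinuous action are finite, so they are trivial in a torsion-free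
group. -/
lemma actsFreely (htf : IsTorsionFreeGroup Γ) {S : Set Cyl}
    (hpd : ActsProperlyDiscontinuously Γ S) : ActsFreely Γ S := by
  intro γ hγ p hp hfix
  apply htf γ hγ
  by_contra hord
  have hinj := injective_pow_iff_not_isOfFinOrder.mpr hord
  have hfin := hpd {p} (singleton_subset_iff.mpr hp) isCompact_singleton
  refine infinite_range_of_injective hinj (hfin.subset ?_)
  rintro _ ⟨n, rfl⟩
  refine ⟨pow_mem hγ n, p, ⟨p, rfl, ?_⟩, rfl⟩
  induction n with
  | zero => rfl
  | succ n ih =>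
    simp only [pow_succ, Homeomorph.mul_apply, hfix] at ih ⊢
    exact ih

end

section

/-! ### Time orientation -/

variable {L : Set Cyl} {Γ : Subgroup (Cyl ≃ₜ Cyl)}

/-- The orientation of the pair of projections of two vectors to the negative plane of the first
two coordinates. -/
def orient (u w : Fin 4 → ℝ) : ℝ := u 0 * w 1 - u 1 * w 0

lemma orient_toR22 (p q : Cyl) : orient (toR22 p) (toR22 q) = Real.sin (q.2 - p.2) := by
  rw [Real.sin_sub]
  simp [orient, toR22]
  ring

/-- The vectors `u` and `w` span a negative definite plane. -/
def SpansNegative (u w : Fin 4 → ℝ) : Prop :=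
  ∀ a b : ℝ, a ≠ 0 ∨ b ≠ 0 → ip (a • u + b • w) (a • u + b • w) < 0

lemma SpansNegative.mulVec {u w : Fin 4 → ℝ} (h : SpansNegative u w) {A : GL (Fin 4) ℝ}
    (hA : A ∈ O22) : SpansNegative (A.1.mulVec u) (A.1.mulVec w) := by
  intro a b hab
  rw [← Matrix.mulVec_smul, ← Matrix.mulVec_smul, ← Matrix.mulVec_add, ip_mulVec hA]
  exact h a b hab

/-- A negative definite plane projects isomorphically to the plane of the first two coordinates. -/
lemma SpansNegative.orient_ne_zero {u w : Fin 4 → ℝ} (h : SpansNegative u w) : orient u w ≠ 0 := by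
  intro h0
  have key : ∀ a b : ℝ, a * u 0 + b * w 0 = 0 → a * u 1 + b * w 1 = 0 → a = 0 ∧ b = 0 := by
    intro a b h1 h2
    by_contra hab
    have := h a b (by tauto)
    simp only [ip, Pi.add_apply, Pi.smul_apply, smul_eq_mul, h1, h2] at this
    nlinarith [sq_nonneg (a * u 2 + b * w 2), sq_nonneg (a * u 3 + b * w 3)]
  unfold orient at h0
  obtain ⟨h1, h2⟩ := key (w 0) (-u 0) (by ring) (by linarith)
  obtain ⟨h3, h4⟩ := key (w 1) (-u 1) (by linarith) (by ring)
  have := key 1 0 (by linarith) (by linarith)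
  exact one_ne_zero this.1

/-- Elements of the neutral component of `O(2,2)` preserve the orientation of negative definite
planes. -/
lemma orient_pos {u w : Fin 4 → ℝ} (h : SpansNegative u w) (hpos : 0 < orient u w)
    {A : GL (Fin 4) ℝ} (hA : A ∈ SO22) : 0 < orient (A.1.mulVec u) (A.1.mulVec w) := by
  obtain ⟨B, hB, rfl⟩ := hA
  let f : O22 → ℝ := fun C => orient (C.1.1.mulVec u) (C.1.1.mulVec w)
  have hf : Continuous f := by
    have h1 : Continuous fun C : O22 => C.1.1 := Units.continuous_val.comp continuous_subtype_val
    have h2 : ∀ (v : Fin 4 → ℝ) (i : Fin 4), Continuous fun C : O22 => C.1.1.mulVec v i := by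
      intro v i
      have h3 : Continuous fun M : Matrix (Fin 4) (Fin 4) ℝ => M.mulVec v i := by fun_prop
      exact h3.comp h1
    exact ((h2 u 0).mul (h2 w 1)).sub ((h2 u 1).mul (h2 w 0))
  have hconn : IsPreconnected (connectedComponent (1 : O22)) := isPreconnected_connectedComponent
  by_contra hle
  have hone : (0 : ℝ) ≤ f 1 := by
    simpa [f] using hpos.le
  obtain ⟨C, -, hC⟩ := hconn.intermediate_value (a := B) (b := 1) hB mem_connectedComponent
    hf.continuousOn ⟨not_lt.mp hle, hone⟩
  exact (h.mulVec C.2).orient_ne_zero hC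

/-- Local version of `IsLift.chron`: two points of a small neighborhood that are timelike related span a
negative definite plane, and the sign of their time difference is the orientation of this pair. -/
lemma IsLift.eventually_chron {A : GL (Fin 4) ℝ} (hA : A ∈ SO22) {φ : Cyl ≃ₜ Cyl}
    (h : IsLift A φ) {p : Cyl} (hp : p ∈ adsTilde) :
    ∀ᶠ x : Cyl × Cyl in 𝓝 (p, p), Chron x.1 x.2 → Chron (φ x.1) (φ x.2) := by
  have hp0 : 0 < p.1.1 2 := hp
  have hmem : ∀ᶠ x : Cyl × Cyl in 𝓝 (p, p), x.1 ∈ adsTilde ∧ x.2 ∈ adsTilde :=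
    (continuous_fst.continuousAt.eventually (isOpen_adsTilde.mem_nhds hp)).and
      (continuous_snd.continuousAt.eventually (isOpen_adsTilde.mem_nhds hp))
  have ht : ∀ᶠ x : Cyl × Cyl in 𝓝 (p, p), x.2.2 - x.1.2 < Real.pi :=
    continuous_time_sub.continuousAt.eventually_lt_const (by simp [Real.pi_pos])
  have ht' : ∀ᶠ x : Cyl × Cyl in 𝓝 (p, p), |(φ x.2).2 - (φ x.1).2| < Real.pi := by
    have h1 : Continuous fun x : Cyl × Cyl => (φ x.1, φ x.2) := by fun_prop
    exact (continuous_time_sub.comp h1).abs.continuousAt.eventually_lt_const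
      (by simp [Real.pi_pos])
  have hip : ∀ᶠ x : Cyl × Cyl in 𝓝 (p, p),
      ip (toR22 x.1) (toR22 x.2) - x.1.1.1 2 * x.2.1.1 2 < 0 := by
    have h1 : Continuous fun x : Cyl × Cyl => ip (toR22 x.1) (toR22 x.2) :=
      continuous_ip.comp ((continuous_toR22.comp continuous_fst).prodMk
        (continuous_toR22.comp continuous_snd))
    have h2 : Continuous fun x : Cyl × Cyl => x.1.1.1 2 * x.2.1.1 2 := by fun_prop
    refine (h1.sub h2).continuousAt.eventually_lt_const ?_
    simp only [Pi.sub_apply, ip_toR22_self]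
    nlinarith
  filter_upwards [hmem, ht, ht', hip] with x hx hxt hxt' hxip hchron
  obtain ⟨r, hr, h1, h2⟩ := h.spec (SO22_le_O22 hA) x.1
  obtain ⟨r', hr', h1', h2'⟩ := h.spec (SO22_le_O22 hA) x.2
  have hx1 : 0 < x.1.1.1 2 := hx.1
  have hx2 : 0 < x.2.1.1 2 := hx.2
  have hd := sphDist_nonneg x.1.1 x.2.1
  have hchron' : sphDist x.1.1 x.2.1 < x.2.2 - x.1.2 := hchron
  have hcos := Real.cos_lt_cos_of_nonneg_of_le_pi hd hxt.le hchron'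
  have hipx := ip_toR22 x.1 x.2
  rw [← Real.cos_neg (x.1.2 - x.2.2), neg_sub] at hipx
  have hlow : 0 < ip (toR22 x.1) (toR22 x.2) + x.1.1.1 2 * x.2.1.1 2 := by linarith
  have hspan : SpansNegative (toR22 x.1) (toR22 x.2) := by
    intro a b hab
    simp only [ip_add_left, ip_add_right, ip_smul_left, ip_smul_right, ip_toR22_self,
      ip_comm (toR22 x.2) (toR22 x.1)]
    set c := ip (toR22 x.1) (toR22 x.2)
    set α := x.1.1.1 2
    set β := x.2.1.1 2
    have hbound : 2 * (a * b * c) ≤ 2 * |a * b| * |c| := by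
      have := le_abs_self (a * b * c)
      rw [abs_mul] at this
      linarith
    have hc : |c| < α * β := abs_lt.mpr ⟨by linarith, by linarith⟩
    by_cases hab0 : a * b = 0
    · rcases mul_eq_zero.mp hab0 with h0 | h0
      · have hb : b ≠ 0 := by tauto
        have := mul_pos (sq_pos_of_ne_zero hb) (sq_pos_of_ne_zero hx2.ne')
        rw [h0]; nlinarith
      · have ha : a ≠ 0 := by tauto
        have := mul_pos (sq_pos_of_ne_zero ha) (sq_pos_of_ne_zero hx1.ne')
        rw [h0]; nlinarith
    · have h3 : |a * b| * |c| < |a * b| * (α * β) :=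
        mul_lt_mul_of_pos_left hc (abs_pos.mpr hab0)
      have h4 := two_mul_le_add_sq (|a| * α) (|b| * β)
      rw [mul_pow, mul_pow, sq_abs, sq_abs] at h4
      rw [abs_mul a b] at h3 hbound
      nlinarith
  have hor : 0 < orient (toR22 x.1) (toR22 x.2) := by
    rw [orient_toR22]
    exact Real.sin_pos_of_pos_of_lt_pi (by linarith) hxt
  have hor' := orient_pos hspan hor hA
  have hsin : 0 < Real.sin ((φ x.2).2 - (φ x.1).2) := by
    rw [← orient_toR22, h1, h1']
    have := mul_pos (mul_pos hr hr') hor'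
    simp only [orient, Pi.smul_apply, smul_eq_mul] at this ⊢
    linarith
  have hpos : 0 < (φ x.2).2 - (φ x.1).2 := by
    by_contra hle
    exact absurd (Real.sin_nonpos_of_nonpos_of_neg_pi_le (not_lt.mp hle)
      (abs_lt.mp hxt').1.le) (not_le.mpr hsin)
  have hip' := ip_toR22 (φ x.1) (φ x.2)
  rw [← Real.cos_neg ((φ x.1).2 - _), neg_sub, h2, h2', h1, h1', ip_smul_left, ip_smul_right,
    ip_mulVec (SO22_le_O22 hA)] at hip'
  have hfin : Real.cos ((φ x.2).2 - (φ x.1).2) < Real.cos (sphDist (φ x.1).1 (φ x.2).1) := by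
    have := mul_pos (mul_pos hr hr') hlow
    linarith
  by_contra hnot
  have := Real.cos_le_cos_of_nonneg_of_le_pi hpos.le (sphDist_le_pi _ _) (not_lt.mp hnot)
  linarith

lemma FutureTimelikeAt.continuousAt {b : ℝ → Cyl} {t : ℝ} (h : FutureTimelikeAt b t) :
    ContinuousAt b t := by
  have h1 : Tendsto (ambient b) (𝓝 t) (𝓝 (ambient b t)) := h.1.continuousAt
  have hx : Tendsto (fun s => (b s).1) (𝓝 t) (𝓝 (b t).1) := by
    rw [tendsto_subtype_rng]
    exact (continuous_fst.tendsto (ambient b t)).comp h1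
  have ht : Tendsto (fun s => (b s).2) (𝓝 t) (𝓝 (b t).2) :=
    (continuous_snd.tendsto (ambient b t)).comp h1
  exact hx.prodMk_nhds ht

/-- The isometries of the universal anti-de Sitter space preserve the chronological order. -/
lemma IsLift.chron {A : GL (Fin 4) ℝ} (hA : A ∈ SO22) {φ : Cyl ≃ₜ Cyl} (h : IsLift A φ)
    {p q : Cyl} (hp : p ∈ adsTilde) (hq : q ∈ adsTilde) (hpq : Chron p q) :
    Chron (φ p) (φ q) := by
  obtain ⟨b, hb0, hb1, hb⟩ := hpq.exists_curve (Or.inl ⟨hp, hq, rfl⟩)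
  rw [← hb0, ← hb1]
  refine rel_of_local (R := Chron) (fun _ _ _ => Chron.trans) (fun s => φ (b s)) zero_lt_one fun t ht => ?_
  obtain ⟨htl, hS⟩ := hb t ht
  have hev := h.eventually_chron hA hS.self_of_nhds
  have hc := htl.continuousAt
  have hl : Tendsto (fun s => (b t, b s)) (𝓝 t) (𝓝 (b t, b t)) :=
    Tendsto.prodMk_nhds tendsto_const_nhds hc
  have hr : Tendsto (fun s => (b s, b t)) (𝓝 t) (𝓝 (b t, b t)) :=
    Tendsto.prodMk_nhds hc tendsto_const_nhds
  constructor
  · filter_upwards [htl.chron.1, (hl.eventually hev).filter_mono nhdsWithin_le_nhds] with s h1 h2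
      using h2 h1
  · filter_upwards [htl.chron.2, (hr.eventually hev).filter_mono nhdsWithin_le_nhds] with s h1 h2
      using h2 h1

lemma IsLift.causal {A : GL (Fin 4) ℝ} (hA : A ∈ SO22) {φ : Cyl ≃ₜ Cyl} (h : IsLift A φ)
    {p q : Cyl} (hp : p ∈ adsTilde) (hq : q ∈ adsTilde) (hpq : Causal p q) :
    Causal (φ p) (φ q) := by
  have hlim : Tendsto (fun ε : ℝ => (φ p, φ (q.1, q.2 + ε))) (𝓝[>] 0) (𝓝 (φ p, φ q)) := by
    have h1 : Continuous fun ε : ℝ => (φ p, φ (q.1, q.2 + ε)) := by fun_prop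
    have := (h1.tendsto 0).mono_left (nhdsWithin_le_nhds (s := Ioi 0))
    simpa using this
  have hev : ∀ᶠ ε : ℝ in 𝓝[>] 0, (φ p, φ (q.1, q.2 + ε)) ∈ {x : Cyl × Cyl | Causal x.1 x.2} := by
    filter_upwards [self_mem_nhdsWithin] with ε hε
    have hlt : Chron p (q.1, q.2 + ε) := by
      have hε : 0 < ε := hε
      have hpq' : sphDist p.1 q.1 ≤ q.2 - p.2 := hpq
      show sphDist p.1 q.1 < q.2 + ε - p.2
      linarith
    have hq' : ((q.1, q.2 + ε) : Cyl) ∈ adsTilde := hq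
    exact (h.chron hA hp hq' hlt).causal
  have := isClosed_causal.mem_of_tendsto hlim hev
  exact this

/-! ### Perturbations of points of anti-de Sitter space -/

/-- The cone over a neighborhood of a point of the universal anti-de Sitter space is a neighborhood
of the vector that represents it. -/
lemma eventually_exists_smul {p : Cyl} (hp : p ∈ adsTilde) {U : Set Cyl} (hU : U ∈ 𝓝 p)
    (v : Fin 4 → ℝ) : ∀ᶠ ε : ℝ in 𝓝 0, ∃ q ∈ U, ∃ r : ℝ, 0 < r ∧
      toR22 q = r • (toR22 p + ε • v) := by
  classical
  have hp0 : 0 < p.1.1 2 := hp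
  -- after a rotation by `-p.2` in the time plane, the first two coordinates are close to `(1, 0)`
  let c : ℝ → ℝ := fun ε => 1 + ε * (Real.cos p.2 * v 0 + Real.sin p.2 * v 1)
  let s : ℝ → ℝ := fun ε => ε * (Real.cos p.2 * v 1 - Real.sin p.2 * v 0)
  let N : ℝ → ℝ := fun ε => √(c ε ^ 2 + s ε ^ 2)
  let t : ℝ → ℝ := fun ε => p.2 + Real.arctan (s ε / c ε)
  let x : ℝ → ℝ := fun ε => (N ε)⁻¹ * (p.1.1 0 + ε * v 2)
  let y : ℝ → ℝ := fun ε => (N ε)⁻¹ * (p.1.1 1 + ε * v 3)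
  have hc : Continuous c := by fun_prop
  have hs : Continuous s := by fun_prop
  have hN : Continuous N := by fun_prop
  have hc0 : c 0 = 1 := by simp [c]
  have hs0 : s 0 = 0 := by simp [s]
  have hN0 : N 0 = 1 := by simp [N, hc0, hs0]
  have ht : ContinuousAt t 0 := by
    refine continuousAt_const.add (Real.continuous_arctan.continuousAt.comp ?_)
    exact hs.continuousAt.div hc.continuousAt (by rw [hc0]; exact one_ne_zero)
  have ht0 : t 0 = p.2 := by simp [t, hs0]
  have hNinv : ContinuousAt (fun ε => (N ε)⁻¹) 0 :=
    hN.continuousAt.inv₀ (by rw [hN0]; exact one_ne_zero)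
  have hx : ContinuousAt x 0 := hNinv.mul (by fun_prop)
  have hy : ContinuousAt y 0 := hNinv.mul (by fun_prop)
  have hx0 : x 0 = p.1.1 0 := by simp [x, hN0]
  have hy0 : y 0 = p.1.1 1 := by simp [y, hN0]
  have hxy : ∀ᶠ ε in 𝓝 0, x ε ^ 2 + y ε ^ 2 < 1 := by
    refine ((hx.pow 2).add (hy.pow 2)).eventually_lt_const ?_
    simp only [Pi.add_apply, Pi.pow_apply, hx0, hy0]
    nlinarith [coord_sq p.1]
  let e : ℝ → E3 := fun ε => !₂[x ε, y ε, √(1 - x ε ^ 2 - y ε ^ 2)]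
  have he : ∀ ε, x ε ^ 2 + y ε ^ 2 < 1 → ‖e ε‖ = 1 ∧ 0 ≤ e ε 2 := by
    intro ε h
    refine ⟨?_, by simp [e, Real.sqrt_nonneg]⟩
    rw [← sq_eq_sq₀ (norm_nonneg _) zero_le_one, norm_sq_coord]
    simp only [e, Matrix.cons_val_zero, Matrix.cons_val_one, Matrix.cons_val]
    rw [Real.sq_sqrt (by linarith)]
    ring
  let q : ℝ → Cyl := fun ε => if h : x ε ^ 2 + y ε ^ 2 < 1 then (⟨e ε, he ε h⟩, t ε) else p
  have hq : ∀ ε, x ε ^ 2 + y ε ^ 2 < 1 → (q ε).1.1 0 = x ε ∧ (q ε).1.1 1 = y ε ∧ (q ε).2 = t ε := by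
    intro ε h
    simp [q, h, e]
  have hlim : Tendsto q (𝓝 0) (𝓝 p) := by
    have h1 : Tendsto (fun ε => (q ε).1) (𝓝 0) (𝓝 p.1) := by
      refine hemisphere_tendsto ?_ ?_
      · rw [← hx0]
        exact hx.tendsto.congr' (hxy.mono fun ε h => (hq ε h).1.symm)
      · rw [← hy0]
        exact hy.tendsto.congr' (hxy.mono fun ε h => (hq ε h).2.1.symm)
    have h2 : Tendsto (fun ε => (q ε).2) (𝓝 0) (𝓝 p.2) := by
      have := ht.tendsto
      rw [ht0] at this
      exact this.congr' (hxy.mono fun ε h => (hq ε h).2.2.symm)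
    exact h1.prodMk_nhds h2
  filter_upwards [hlim.eventually hU, hxy,
    hc.continuousAt.eventually_const_lt (by rw [hc0]; exact one_pos)] with ε h1 h2 h3
  obtain ⟨e0, e1, e2⟩ := hq ε h2
  have hNpos : 0 < N ε := Real.sqrt_pos.mpr (by positivity)
  have hNeq : N ε = c ε * √(1 + (s ε / c ε) ^ 2) := by
    have h4 : c ε ^ 2 + s ε ^ 2 = c ε ^ 2 * (1 + (s ε / c ε) ^ 2) := by field_simp
    show √(c ε ^ 2 + s ε ^ 2) = _
    rw [h4, Real.sqrt_mul (sq_nonneg _), Real.sqrt_sq h3.le]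
  have hcos : Real.cos (Real.arctan (s ε / c ε)) = (N ε)⁻¹ * c ε := by
    rw [Real.cos_arctan, hNeq]
    field_simp
  have hsin : Real.sin (Real.arctan (s ε / c ε)) = (N ε)⁻¹ * s ε := by
    rw [Real.sin_arctan, hNeq]
    field_simp
  have hpyth := Real.sin_sq_add_cos_sq p.2
  refine ⟨q ε, h1, (N ε)⁻¹, inv_pos.mpr hNpos, ?_⟩
  funext i
  fin_cases i
  · show Real.cos (q ε).2 = (N ε)⁻¹ * (Real.cos p.2 + ε * v 0)
    rw [e2, Real.cos_add, hcos, hsin]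
    simp only [c, s]
    linear_combination (N ε)⁻¹ * ε * v 0 * hpyth
  · show Real.sin (q ε).2 = (N ε)⁻¹ * (Real.sin p.2 + ε * v 1)
    rw [e2, Real.sin_add, hcos, hsin]
    simp only [c, s]
    linear_combination (N ε)⁻¹ * ε * v 1 * hpyth
  · show (q ε).1.1 0 = (N ε)⁻¹ * (p.1.1 0 + ε * v 2)
    rw [e0]
  · show (q ε).1.1 1 = (N ε)⁻¹ * (p.1.1 1 + ε * v 3)
    rw [e1]

end

section

/-! ### Causality of the action -/

variable {L : Set Cyl} {Γ : Subgroup (Cyl ≃ₜ Cyl)}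

lemma chron_of_mem (hΓ : Γ ≤ SO22Hat) {γ : Cyl ≃ₜ Cyl} (hγ : γ ∈ Γ) {p q : Cyl}
    (hp : p ∈ adsTilde) (hq : q ∈ adsTilde) (h : Chron p q) : Chron (γ p) (γ q) :=
  let ⟨_, hA, hlift⟩ := hΓ hγ
  hlift.chron hA hp hq h

lemma causal_of_mem (hΓ : Γ ≤ SO22Hat) {γ : Cyl ≃ₜ Cyl} (hγ : γ ∈ Γ) {p q : Cyl}
    (hp : p ∈ adsTilde) (hq : q ∈ adsTilde) (h : Causal p q) : Causal (γ p) (γ q) :=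
  let ⟨_, hA, hlift⟩ := hΓ hγ
  hlift.causal hA hp hq h

/-- Points bounded above by `q` for the causal order converge to `q` as soon as their times do. -/
lemma tendsto_of_causal {a : ℕ → Cyl} {q : Cyl} (h : ∀ n, Causal (a n) q)
    (ht : Tendsto (fun n => (a n).2) atTop (𝓝 q.2)) : Tendsto a atTop (𝓝 q) := by
  have hx : Tendsto (fun n => (a n).1) atTop (𝓝 q.1) := by
    rw [tendsto_iff_dist_tendsto_zero]
    have h0 : Tendsto (fun n => q.2 - (a n).2) atTop (𝓝 0) := by
      simpa using ht.const_sub q.2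
    exact squeeze_zero (fun _ => dist_nonneg) (fun n => (dist_le_sphDist _ _).trans (h n)) h0
  exact hx.prodMk_nhds ht

/-- Bounded chronologically increasing sequences converge, to an upper bound. -/
lemma exists_tendsto_of_chron {P : ℕ → Cyl} (hP : ∀ n, Chron (P n) (P (n + 1))) {M : ℝ}
    (hM : ∀ n, (P n).2 ≤ M) : ∃ q, Tendsto P atTop (𝓝 q) ∧ ∀ n, Causal (P n) q := by
  have hmono : Monotone fun n => (P n).2 := monotone_nat_of_le_succ fun n => (hP n).lt.le
  have htime : Tendsto (fun n => (P n).2) atTop (𝓝 (⨆ n, (P n).2)) :=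
    tendsto_atTop_ciSup hmono ⟨M, by rintro _ ⟨n, rfl⟩; exact hM n⟩
  obtain ⟨x, -, ψ, hψ, hx⟩ := isCompact_univ.tendsto_subseq (x := fun n => (P n).1)
    fun _ => mem_univ _
  set q : Cyl := (x, ⨆ n, (P n).2)
  have hlt : ∀ n m, n < m → Chron (P n) (P m) := by
    intro n m hnm
    induction hnm with
    | refl => exact hP n
    | step _ ih => exact ih.trans (hP _)
  have hsub : Tendsto (fun k => P (ψ k)) atTop (𝓝 q) :=
    hx.prodMk_nhds (htime.comp hψ.tendsto_atTop)
  have hcausal : ∀ n, Causal (P n) q := by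
    intro n
    have h1 : Tendsto (fun k => (P n, P (ψ k))) atTop (𝓝 (P n, q)) :=
      Tendsto.prodMk_nhds tendsto_const_nhds hsub
    have h2 : ∀ᶠ k in atTop, (P n, P (ψ k)) ∈ {x : Cyl × Cyl | Causal x.1 x.2} := by
      filter_upwards [hψ.tendsto_atTop.eventually (eventually_gt_atTop n)] with k hk
      exact (hlt n _ hk).causal
    have := isClosed_causal.mem_of_tendsto h1 h2
    exact this
  exact ⟨q, tendsto_of_causal hcausal htime, hcausal⟩

lemma IsLimitSet.ip_nonpos (hL : IsLimitSet L) {y z : Cyl} (hy : y ∈ L) (hz : z ∈ L) :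
    ip (toR22 y) (toR22 z) ≤ 0 := by
  have h := hL.abs_sub_le y hy z hz
  rw [ip_toR22, show y.1.1 2 = 0 from hL.subset hy, zero_mul, sub_zero, sub_nonpos,
    ← Real.cos_abs (y.2 - z.2)]
  exact Real.cos_le_cos_of_nonneg_of_le_pi (abs_nonneg _) (sphDist_le_pi _ _) h

namespace DivergesTo

variable {γ : ℕ → Cyl ≃ₜ Cyl} {A : ℕ → GL (Fin 4) ℝ} {s : ℕ → ℝ} {B : Matrix (Fin 4) (Fin 4) ℝ}

lemma tendsto_ip_mulVec (h : DivergesTo L γ A s B) {u w : ℕ → Fin 4 → ℝ} {u₀ w₀ : Fin 4 → ℝ}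
    (hu : Tendsto u atTop (𝓝 u₀)) (hw : Tendsto w atTop (𝓝 w₀)) :
    Tendsto (fun n => (s n)⁻¹ * ip (u n) ((A n).1.mulVec (w n))) atTop (𝓝 (ip u₀ (B.mulVec w₀))) :=
  (tendsto_ip hu (h.tendsto_mulVec hw)).congr fun _ => ip_smul_right _ _ _

/-- If `p n` causally precedes the image of `p' n`, then the limits satisfy `0 ≤ ip q (B q')`. -/
lemma ip_nonneg_of_causal (h : DivergesTo L γ A s B) (hL : IsLimitSet L) {p p' : ℕ → Cyl}
    {q q' : Cyl} (hp : ∀ n, p n ∈ invisible L) (hp' : ∀ n, γ n (p' n) ∈ invisible L)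
    (hq : Tendsto p atTop (𝓝 q)) (hq' : Tendsto p' atTop (𝓝 q'))
    (hc : ∀ᶠ n in atTop, Causal (p n) (γ n (p' n))) :
    0 ≤ ip (toR22 q) (B.mulVec (toR22 q')) := by
  have h1 := h.tendsto_ip_mulVec ((continuous_toR22.tendsto q).comp hq)
    ((continuous_toR22.tendsto q').comp hq')
  have h2 : Tendsto (fun n => -(s n)⁻¹) atTop (𝓝 0) := by
    simpa using h.tendsto_atTop.inv_tendsto_atTop.neg
  refine le_of_tendsto_of_tendsto h2 h1 ?_
  filter_upwards [hc] with n hn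
  obtain ⟨r, hr, e1, e2⟩ := (h.lift n).spec (h.mem n) (p' n)
  have h3 := AdSCausal.ip_nonneg_of_causal hL (hp n) (hp' n) hn
  rw [e1, e2, ip_smul_right] at h3
  have h4 : 0 ≤ ip (toR22 (p n)) ((A n).1.mulVec (toR22 (p' n))) + (p n).1.1 2 * (p' n).1.1 2 := by
    by_contra hneg
    have := mul_neg_of_pos_of_neg hr (not_le.mp hneg)
    linarith
  have h5 : (p n).1.1 2 * (p' n).1.1 2 ≤ 1 :=
    mul_le_one₀ (coord_two_le_one _) (coord_two_nonneg _) (coord_two_le_one _)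
  have h6 := mul_le_mul_of_nonneg_left
    (show -1 ≤ ip (toR22 (p n)) ((A n).1.mulVec (toR22 (p' n))) by linarith)
    (inv_pos.mpr (h.pos n)).le
  simp only [Function.comp]
  linarith

end DivergesTo

section

variable (hL : IsLimitSet L) (hΓ : Γ ≤ SO22Hat) (hdisc : IsDiscreteGroup Γ)
  (htf : IsTorsionFreeGroup Γ) (hinv : Preserves Γ L)

lemma pow_injective (htf : IsTorsionFreeGroup Γ) {γ : Cyl ≃ₜ Cyl} (hγ : γ ∈ Γ) (hne : γ ≠ 1) :
    Function.Injective fun n : ℕ => γ ^ n :=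
  injective_pow_iff_not_isOfFinOrder.mpr fun h => hne (htf γ hγ h)

include hL hΓ hdisc htf hinv

/-- No point of the invisible domain is in the future of one of its translates.  Otherwise the
iterates of all the points near `p` increase to the same limit `q`, and the limit `B` of the
normalized matrices has rank one: its image is spanned by `q`.  As the image contains points of `L`
and `B` sends `p` to the closed future of `p`, this contradicts that `p` is invisible from `L`. -/
lemma not_chron_apply {γ : Cyl ≃ₜ Cyl} (hγ : γ ∈ Γ) {p : Cyl} (hp : p ∈ adsTilde)
    (hp' : p ∈ invisible L) : ¬ Chron p (γ p) := by
  intro hchron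
  have hne : γ ≠ 1 := by
    rintro rfl
    exact not_chron_self p hchron
  have hinj := pow_injective htf hγ hne
  have hpow : ∀ n, γ ^ n ∈ Γ := fun n => pow_mem hγ n
  have hads : ∀ {g : Cyl ≃ₜ Cyl}, g ∈ Γ → ∀ {x : Cyl}, x ∈ adsTilde → g x ∈ adsTilde :=
    fun hg _ hx => (preserves_adsTilde hΓ).mem hg hx
  have hpowchron : ∀ n : ℕ, Chron ((γ ^ n) p) ((γ ^ (n + 1)) p) := by
    intro n
    rw [pow_succ, Homeomorph.mul_apply]
    exact chron_of_mem hΓ (hpow n) hp (hads hγ hp) hchron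
  obtain ⟨y₀, hy₀⟩ := hL.nonempty
  have hbound : ∀ n : ℕ, ((γ ^ n) p).2 ≤ y₀.2 + Real.pi := by
    intro n
    have h1 := abs_lt.mp (mem_invisible_of_mem hL.subset hΓ hinv (hpow n) hp' y₀ hy₀)
    have h2 := sphDist_le_pi ((γ ^ n) p).1 y₀.1
    linarith
  obtain ⟨q, hq, hqc⟩ := exists_tendsto_of_chron hpowchron hbound
  obtain ⟨ψ, hψ, A, s, B, h⟩ := exists_divergesTo hL.isCompact hL.nonempty hΓ hdisc hinv hpow hinj
  set Q := toR22 q with hQ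
  have hQ0 : Q ≠ 0 := toR22_ne_zero q
  -- the iterates of a point of `U` are intertwined with those of `p`
  let U : Set Cyl := {x | x ∈ adsTilde ∧ Chron (γ⁻¹ p) x ∧ Chron x (γ p)}
  have hU : U ∈ 𝓝 p := by
    have h1 : Chron (γ⁻¹ p) p := by
      have := chron_of_mem hΓ (inv_mem hγ) hp (hads hγ hp) hchron
      rwa [show γ⁻¹ (γ p) = p from γ.symm_apply_apply p] at this
    have e1 : Continuous fun x : Cyl => (γ⁻¹ p, x) := by fun_prop
    have e2 : Continuous fun x : Cyl => (x, γ p) := by fun_prop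
    have o1 : IsOpen {x | Chron (γ⁻¹ p) x} := isOpen_chron.preimage e1
    have o2 : IsOpen {x | Chron x (γ p)} := isOpen_chron.preimage e2
    exact (isOpen_adsTilde.inter (o1.inter o2)).mem_nhds ⟨hp, h1, hchron⟩
  have hlimU : ∀ x ∈ U, Tendsto (fun n : ℕ => (γ ^ (n + 1)) x) atTop (𝓝 q) := by
    rintro x ⟨hx, hx1, hx2⟩
    have hup : ∀ n : ℕ, Chron ((γ ^ (n + 1)) x) ((γ ^ (n + 2)) p) := by
      intro n
      rw [pow_succ γ (n + 1), Homeomorph.mul_apply]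
      exact chron_of_mem hΓ (hpow _) hx (hads hγ hp) hx2
    have hlow : ∀ n : ℕ, Chron ((γ ^ n) p) ((γ ^ (n + 1)) x) := by
      intro n
      have := chron_of_mem hΓ (hpow (n + 1)) (hads (inv_mem hγ) hp) hx hx1
      rwa [pow_succ γ n, Homeomorph.mul_apply, Homeomorph.mul_apply,
        show γ (γ⁻¹ p) = p from γ.apply_symm_apply p, ← Homeomorph.mul_apply, ← pow_succ] at this
    have hqt : Tendsto (fun n : ℕ => ((γ ^ n) p).2) atTop (𝓝 q.2) :=
      (continuous_snd.tendsto q).comp hq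
    exact tendsto_of_causal (fun n => ((hup n).trans_causal (hqc _)).causal)
      (tendsto_of_tendsto_of_tendsto_of_le_of_le hqt (hqt.comp (tendsto_add_atTop_nat 2))
        (fun n => (hlow n).lt.le) (fun n => (hup n).lt.le))
  have hdir : ∀ x ∈ U, ∃ l : ℝ, 0 ≤ l ∧ B.mulVec (toR22 x) = l • Q := by
    intro x hx
    have h1 : Tendsto (fun n : ℕ => (γ ^ n) x) atTop (𝓝 q) :=
      (tendsto_add_atTop_iff_nat 1).mp (hlimU x hx)
    exact h.exists_nonneg_smul (p := fun _ => x) tendsto_const_nhds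
      ((continuous_toR22.tendsto q).comp (h1.comp hψ.tendsto_atTop)) hQ0
  obtain ⟨y, hy, hBy⟩ := h.exists_mulVec_ne_zero hL
  obtain ⟨z, hz, hBz⟩ := h.symm.exists_mulVec_ne_zero hL
  obtain ⟨l, hl, hBp⟩ := hdir p (mem_of_mem_nhds hU)
  -- the image of `y` is also proportional to `q`, as `p + ε • y` is represented by a point near `p`
  obtain ⟨c, hc⟩ : ∃ c : ℝ, B.mulVec (toR22 y) = c • Q := by
    obtain ⟨ε, ⟨x, hx, r, hr, hrx⟩, hε⟩ := (((eventually_exists_smul hp hU (toR22 y)).filter_mono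
      nhdsWithin_le_nhds).and (self_mem_nhdsWithin (s := Ioi 0))).exists
    have hε : 0 < ε := hε
    obtain ⟨l', -, hl'⟩ := hdir x hx
    rw [hrx, Matrix.mulVec_smul, Matrix.mulVec_add, Matrix.mulVec_smul, hBp] at hl'
    refine ⟨ε⁻¹ * (r⁻¹ * l' - l), ?_⟩
    have h1 : l • Q + ε • B.mulVec (toR22 y) = (r⁻¹ * l') • Q := by
      rw [mul_smul, ← hl', smul_smul, inv_mul_cancel₀ hr.ne', one_smul]
    have h2 : ε • B.mulVec (toR22 y) = (r⁻¹ * l' - l) • Q := by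
      rw [sub_smul, ← h1, add_sub_cancel_left]
    rw [mul_smul, ← h2, smul_smul, inv_mul_cancel₀ hε.ne', one_smul]
  have hzp : ip (toR22 z) (B.mulVec (toR22 p)) < 0 := by
    rw [ip_adj, ip_comm]
    exact h.symm.ip_mulVec_neg hL hp' hz hBz
  rw [hBp, ip_smul_right] at hzp
  have hzQ : ip (toR22 z) Q < 0 := by
    by_contra hge
    exact absurd (mul_nonneg hl (not_lt.mp hge)) (not_le.mpr hzp)
  have hzy : ip (toR22 z) (B.mulVec (toR22 y)) ≤ 0 := by
    obtain ⟨w, hw, k, hk, hk'⟩ := h.exists_mem hL.isCompact hy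
    rw [hk', ip_smul_right]
    exact mul_nonpos_of_nonneg_of_nonpos hk (hL.ip_nonpos hz hw)
  rw [hc, ip_smul_right] at hzy
  have hc0 : 0 ≤ c := by
    by_contra hneg
    exact absurd (mul_pos_of_neg_of_neg (not_le.mp hneg) hzQ) (not_lt.mpr hzy)
  have hpy := h.ip_mulVec_neg hL hp' hy hBy
  rw [hc, ip_smul_right] at hpy
  have hpQ : ip (toR22 p) Q < 0 := by
    by_contra hge
    exact absurd (mul_nonneg hc0 (not_lt.mp hge)) (not_le.mpr hpy)
  have hl0 : l ≠ 0 := by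
    rintro rfl
    simp at hzp
  -- so `B p` is a positive multiple of `q` with `⟨p, q⟩ < 0`, while `p` precedes its iterates
  have hpp := h.ip_nonneg_of_causal hL (p := fun _ => p) (p' := fun _ => p) (fun _ => hp')
    (fun n => mem_invisible_of_mem hL.subset hΓ hinv (hpow _) hp') tendsto_const_nhds
    tendsto_const_nhds (Eventually.of_forall fun n => ?_)
  · rw [hBp, ip_smul_right] at hpp
    exact absurd (mul_neg_of_pos_of_neg (hl.lt_of_ne' hl0) hpQ) (not_lt.mpr hpp)
  · have hc : ∀ n : ℕ, Causal p ((γ ^ n) p) := by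
      intro n
      induction n with
      | zero => simp [Causal, sphDist_self]
      | succ n ih => exact ih.trans (hpowchron n).causal
    exact hc _

/-- Almost closed causal curves do not exist in the quotient.  Otherwise `⟨x, Bx⟩ ≤ 0` for all `x`
near `p`, by the previous lemma, with equality at `x = p`; but the derivative at `p` in direction
of a point of `L` does not vanish. -/
lemma not_causal_of_injective {γ : ℕ → Cyl ≃ₜ Cyl} (hγ : ∀ n, γ n ∈ Γ)
    (hinj : Function.Injective γ) {p : Cyl} (hp : p ∈ adsTilde) (hp' : p ∈ invisible L)
    {a b : ℕ → Cyl} (ha : ∀ n, a n ∈ invisible L) (hb : ∀ n, b n ∈ invisible L)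
    (hap : Tendsto a atTop (𝓝 p)) (hbp : Tendsto b atTop (𝓝 p))
    (hab : ∀ n, Causal (a n) (γ n (b n))) : False := by
  obtain ⟨ψ, hψ, A, s, B, h⟩ := exists_divergesTo hL.isCompact hL.nonempty hΓ hdisc hinv hγ hinj
  have hpp : 0 ≤ ip (toR22 p) (B.mulVec (toR22 p)) :=
    h.ip_nonneg_of_causal hL (fun n => ha (ψ n))
      (fun n => mem_invisible_of_mem hL.subset hΓ hinv (hγ _) (hb (ψ n)))
      (hap.comp hψ.tendsto_atTop) (hbp.comp hψ.tendsto_atTop)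
      (Eventually.of_forall fun n => hab (ψ n))
  have hle : ∀ x ∈ adsTilde ∩ invisible L, ip (toR22 x) (B.mulVec (toR22 x)) ≤ 0 := by
    rintro x ⟨hx, hx'⟩
    refine le_of_tendsto (h.tendsto_ip_mulVec tendsto_const_nhds tendsto_const_nhds)
      (Eventually.of_forall fun n => ?_)
    have hg := hγ (ψ n)
    have hgx := mem_invisible_of_mem hL.subset hΓ hinv hg hx'
    have h1 : ¬ (Chron x (γ (ψ n) x) ∨ Chron (γ (ψ n) x) x) := by
      rintro (h1 | h1)
      · exact not_chron_apply hL hΓ hdisc htf hinv hg hx hx' h1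
      · have h2 := not_chron_apply hL hΓ hdisc htf hinv (inv_mem hg)
          ((preserves_adsTilde hΓ).mem hg hx) hgx
        rw [show (γ (ψ n))⁻¹ (γ (ψ n) x) = x from (γ (ψ n)).symm_apply_apply x] at h2
        exact h2 h1
    rw [chron_or_chron_iff hL hx' hgx, not_lt] at h1
    obtain ⟨r, hr, e1, e2⟩ := (h.lift n).spec (h.mem n) x
    simp only [Function.comp] at e1 e2
    rw [e1, e2, ip_smul_right] at h1
    have h3 : 0 ≤ r * (x.1.1 2 * x.1.1 2) :=
      mul_nonneg hr.le (mul_nonneg (coord_two_nonneg _) (coord_two_nonneg _))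
    have h4 : ip (toR22 x) ((A n).1.mulVec (toR22 x)) ≤ 0 := by
      by_contra hpos
      have := mul_pos hr (not_le.mp hpos)
      linarith
    exact mul_nonpos_of_nonneg_of_nonpos (inv_pos.mpr (h.pos n)).le h4
  obtain ⟨y, hy, hBy⟩ := h.exists_mulVec_ne_zero hL
  have h1 := h.ip_mulVec_neg hL hp' hy hBy
  have h2 : ip (toR22 y) (B.mulVec (toR22 p)) ≤ 0 := by
    rw [ip_adj, ip_comm]
    exact h.symm.ip_mulVec_nonpos hL hp' hy
  set u := toR22 p
  set v := toR22 y
  set β := ip u (B.mulVec v) + ip v (B.mulVec u)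
  set δ := ip v (B.mulVec v)
  -- compare `⟨u + ε v, B (u + ε v)⟩` at `ε < 0` with its value at `ε = 0`
  have hev : ∀ᶠ ε : ℝ in 𝓝[<] 0, 0 ≤ β + ε * δ := by
    have hU : adsTilde ∩ invisible L ∈ 𝓝 p :=
      (isOpen_adsTilde.inter (isOpen_invisible hL)).mem_nhds ⟨hp, hp'⟩
    filter_upwards [(eventually_exists_smul hp hU v).filter_mono nhdsWithin_le_nhds,
      self_mem_nhdsWithin] with ε ⟨x, hx, r, hr, hrx⟩ hε
    have hε : ε < 0 := hε
    have h3 := hle x hx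
    rw [hrx] at h3
    simp only [Matrix.mulVec_smul, Matrix.mulVec_add, ip_smul_left, ip_smul_right, ip_add_left,
      ip_add_right] at h3
    have h4 : r * (r * (ip u (B.mulVec u) + ε * (β + ε * δ))) ≤ 0 := by
      refine le_trans (le_of_eq ?_) h3
      simp only [β, δ]
      ring
    have h5 : ε * (β + ε * δ) ≤ 0 := by
      by_contra hpos
      have := mul_pos hr (mul_pos hr (add_pos_of_nonneg_of_pos hpp (not_le.mp hpos)))
      linarith
    by_contra hneg
    exact absurd (mul_pos_of_neg_of_neg hε (not_le.mp hneg)) (not_lt.mpr h5)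
  have hlim : Tendsto (fun ε : ℝ => β + ε * δ) (𝓝[<] 0) (𝓝 β) := by
    have hcont : Continuous fun ε : ℝ => β + ε * δ := by fun_prop
    have := (hcont.tendsto 0).mono_left (nhdsWithin_le_nhds (s := Iio 0))
    simpa using this
  have := ge_of_tendsto hlim hev
  linarith

/-- Strong causality at `p`, upstairs: points close to `p` are not causally related to nontrivial
translates of points close to `p`. -/
lemma eq_one_of_causal {p : Cyl} (hp : p ∈ adsTilde) (hp' : p ∈ invisible L) {γ : ℕ → Cyl ≃ₜ Cyl}
    (hγ : ∀ n, γ n ∈ Γ) {a b : ℕ → Cyl} (ha : ∀ n, a n ∈ invisible L)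
    (hb : ∀ n, b n ∈ invisible L) (hap : Tendsto a atTop (𝓝 p)) (hbp : Tendsto b atTop (𝓝 p))
    (hab : ∀ n, Causal (a n) (γ n (b n))) : ∃ n, γ n = 1 := by
  by_contra! hne
  -- a value `g` taken infinitely often gives `p ≤ g p`, hence `p ≤ gⁿ p` for all `n`
  rcases (range γ).finite_or_infinite with hfin | hinf
  · obtain ⟨g, hg⟩ : ∃ g ∈ range γ, ∃ᶠ n in atTop, γ n = g := by
      by_contra! hnot
      have h1 : ∀ᶠ n in atTop, ∀ g ∈ range γ, γ n ≠ g :=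
        (eventually_all_finite hfin).mpr fun g hg => hnot g hg
      obtain ⟨n, hn⟩ := h1.exists
      exact hn _ ⟨n, rfl⟩ rfl
    obtain ⟨⟨m, rfl⟩, hfreq⟩ := hg
    set g := γ m with hgm
    have hlim : Tendsto (fun n => (a n, g (b n))) atTop (𝓝 (p, g p)) :=
      hap.prodMk_nhds ((g.continuous.tendsto p).comp hbp)
    have hpg : Causal p (g p) := by
      have h1 : ∃ᶠ n in atTop, (a n, g (b n)) ∈ {x : Cyl × Cyl | Causal x.1 x.2} :=
        hfreq.mono fun n hn => by
          have := hab n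
          rw [hn] at this
          exact this
      have := isClosed_causal.mem_of_frequently_of_tendsto h1 hlim
      exact this
    have hpow : ∀ n : ℕ, Causal p ((g ^ n) p) := by
      intro n
      induction n with
      | zero => simp [Causal, sphDist_self]
      | succ n ih =>
        rw [pow_succ, Homeomorph.mul_apply]
        exact ih.trans (causal_of_mem hΓ (pow_mem (hγ m) n) hp
          ((preserves_adsTilde hΓ).mem (hγ m) hp) hpg)
    exact not_causal_of_injective hL hΓ hdisc htf hinv (fun n => pow_mem (hγ m) n)
      (pow_injective htf (hγ m) (hne m)) hp hp' (fun _ => hp') (fun _ => hp') tendsto_const_nhds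
      tendsto_const_nhds hpow
  · let e := hinf.natEmbedding
    choose m hm using fun k => (e k).2
    have hinj : Function.Injective fun k => γ (m k) := by
      intro i j hij
      simp only [hm] at hij
      exact e.injective (Subtype.ext hij)
    have hm' : Tendsto m atTop atTop :=
      Function.Injective.nat_tendsto_atTop fun i j hij => hinj (congrArg γ hij)
    exact not_causal_of_injective hL hΓ hdisc htf hinv (fun k => hγ (m k)) hinj hp hp'
      (fun k => ha (m k)) (fun k => hb (m k)) (hap.comp hm') (hbp.comp hm') fun k => hab (m k)

end

end

section

/-! ### The quotient spacetime -/

variable {L : Set Cyl} {Γ : Subgroup (Cyl ≃ₜ Cyl)} {S : Set Cyl}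

lemma mk_eq_mk_iff (x y : S) : Quotient.mk (orbitSetoid Γ S) x = Quotient.mk (orbitSetoid Γ S) y ↔
    ∃ γ ∈ Γ, γ x.1 = y.1 := Quotient.eq

/-- The chronological order of the quotient is induced by the one of the covering. -/
lemma exists_chron_of_mem_future (hΓ : Γ ≤ SO22Hat) (hS : S ⊆ adsTilde) (hinv : Preserves Γ S)
    {x y : S} (h : Quotient.mk (orbitSetoid Γ S) y ∈ future Γ S (Quotient.mk _ x)) :
    ∃ γ ∈ Γ, Chron x.1 (γ y.1) := by
  obtain ⟨c, hc, hc0, hc1⟩ := h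
  let R : QuotientSpace Γ S → QuotientSpace Γ S → Prop := fun u v =>
    ∃ x y : S, Quotient.mk _ x = u ∧ Quotient.mk _ y = v ∧ Chron x.1 y.1
  have htrans : ∀ u v w, R u v → R v w → R u w := by
    rintro u v w ⟨x, y, rfl, rfl, hxy⟩ ⟨y', z, hy', rfl, hyz⟩
    obtain ⟨γ, hγ, h⟩ := (mk_eq_mk_iff y y').mp hy'.symm
    refine ⟨⟨γ x.1, hinv.mem hγ x.2⟩, z, ?_, rfl, ?_⟩
    · exact ((mk_eq_mk_iff _ _).mpr ⟨γ, hγ, rfl⟩).symm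
    · have := chron_of_mem hΓ hγ (hS x.2) (hS y.2) hxy
      rw [h] at this
      exact this.trans hyz
  have hR : R (c 0) (c 1) := by
    refine rel_of_local htrans c zero_lt_one fun t ht => ?_
    obtain ⟨b, hb, hev⟩ := hc t ht
    obtain ⟨h0, h0'⟩ := hev.self_of_nhds
    constructor
    · filter_upwards [hb.chron.1, hev.filter_mono nhdsWithin_le_nhds] with s h1 ⟨h2, h3⟩
      exact ⟨⟨b t, h0⟩, ⟨b s, h2⟩, h0'.symm, h3.symm, h1⟩
    · filter_upwards [hb.chron.2, hev.filter_mono nhdsWithin_le_nhds] with s h1 ⟨h2, h3⟩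
      exact ⟨⟨b s, h2⟩, ⟨b t, h0⟩, h3.symm, h0'.symm, h1⟩
  obtain ⟨x', y', hx', hy', hxy⟩ := hR
  rw [hc0] at hx'
  rw [hc1] at hy'
  obtain ⟨γ, hγ, h1⟩ := (mk_eq_mk_iff _ _).mp hx'
  obtain ⟨η, hη, h2⟩ := (mk_eq_mk_iff _ _).mp hy'
  have := chron_of_mem hΓ hγ (hS x'.2) (hS y'.2) hxy
  rw [h1] at this
  refine ⟨γ * η⁻¹, mul_mem hγ (inv_mem hη), ?_⟩
  rwa [Homeomorph.mul_apply, ← h2, show η⁻¹ (η y'.1) = y'.1 from η.symm_apply_apply _]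

/-- In an open subset of the universal anti-de Sitter space that contains the points between two
of its points, the chronological order of the cylinder is realized by timelike curves. -/
lemma mem_future_of_chron (hS : S ⊆ adsTilde) (hopen : IsOpen S)
    (hconv : ∀ p ∈ S, ∀ r ∈ S, ∀ q ∈ adsTilde, Causal p q → Causal q r → q ∈ S)
    (hinv : Preserves Γ S) {x y : S} {γ : Cyl ≃ₜ Cyl} (hγ : γ ∈ Γ) (h : Chron x.1 (γ y.1)) :
    Quotient.mk (orbitSetoid Γ S) y ∈ future Γ S (Quotient.mk _ x) := by
  classical
  have hy : γ y.1 ∈ S := hinv.mem hγ y.2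
  obtain ⟨b, hb0, hb1, hb⟩ := h.exists_curve (Or.inl ⟨hS x.2, hS hy, rfl⟩)
  have hmono : ∀ s ∈ Icc (0 : ℝ) 1, ∀ t ∈ Icc (0 : ℝ) 1, s < t → Chron (b s) (b t) :=
    fun s hs t ht hst => rel_of_local (R := Chron) (fun _ _ _ => Chron.trans) b hst fun u hu =>
      (hb u ⟨hs.1.trans hu.1, hu.2.trans ht.2⟩).1.chron
  have hbS : ∀ t ∈ Icc (0 : ℝ) 1, b t ∈ S := by
    intro t ht
    rcases ht.1.eq_or_lt with h0 | h0
    · rw [← h0, hb0]; exact x.2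
    rcases ht.2.eq_or_lt with h1 | h1
    · rw [h1, hb1]; exact hy
    refine hconv x.1 x.2 (γ y.1) hy (b t) (hb t ht).2.self_of_nhds ?_ ?_
    · rw [← hb0]
      exact (hmono 0 (by simp) t ht h0).causal
    · rw [← hb1]
      exact (hmono t ht 1 (by simp) h1).causal
  let c : ℝ → QuotientSpace Γ S := fun s =>
    if h : b s ∈ S then Quotient.mk _ ⟨b s, h⟩ else Quotient.mk _ x
  have hc : ∀ s, ∀ h : b s ∈ S, c s = Quotient.mk _ ⟨b s, h⟩ := fun s h => dif_pos h
  refine ⟨c, fun t ht => ⟨b, (hb t ht).1, ?_⟩, ?_, ?_⟩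
  · filter_upwards [(hb t ht).1.continuousAt.eventually (hopen.mem_nhds (hbS t ht))] with s hs
      using ⟨hs, hc s hs⟩
  · have h0 : b 0 ∈ S := by rw [hb0]; exact x.2
    rw [hc 0 h0]
    congr 1
    exact Subtype.ext hb0
  · have h1 : b 1 ∈ S := by rw [hb1]; exact hy
    rw [hc 1 h1]
    exact ((mk_eq_mk_iff _ _).mpr ⟨γ, hγ, hb1.symm⟩).symm

lemma isOpen_preimage_future (Γ : Subgroup (Cyl ≃ₜ Cyl)) (x : Cyl) :
    IsOpen {y : S | ∃ γ ∈ Γ, Chron x (γ y.1)} := by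
  have : {y : S | ∃ γ ∈ Γ, Chron x (γ y.1)} = ⋃ γ ∈ Γ, {y : S | Chron x (γ y.1)} := by
    ext y; simp
  rw [this]
  refine isOpen_biUnion fun γ _ => ?_
  have h1 : Continuous fun y : S => (x, γ y.1) := by fun_prop
  exact isOpen_chron.preimage h1

lemma isOpen_preimage_past (Γ : Subgroup (Cyl ≃ₜ Cyl)) (y : Cyl) :
    IsOpen {x : S | ∃ γ ∈ Γ, Chron x.1 (γ y)} := by
  have : {x : S | ∃ γ ∈ Γ, Chron x.1 (γ y)} = ⋃ γ ∈ Γ, {x : S | Chron x.1 (γ y)} := by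
    ext y; simp
  rw [this]
  refine isOpen_biUnion fun γ _ => ?_
  have h1 : Continuous fun x : S => (x.1, γ y) := by fun_prop
  exact isOpen_chron.preimage h1

/-- Small diamonds of the covering around `p` project to a basis of neighborhoods of the image of `p`,
and they are the diamonds of the quotient by `eq_one_of_causal`. -/
lemma isStronglyCausal (hL : IsLimitSet L) (hΓ : Γ ≤ SO22Hat) (hdisc : IsDiscreteGroup Γ)
    (htf : IsTorsionFreeGroup Γ) (hinv : Preserves Γ L) :
    IsStronglyCausalQuotient Γ (adsTilde ∩ invisible L) := by
  set E := adsTilde ∩ invisible L with hE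
  have hsub : E ⊆ adsTilde := inter_subset_left
  have hopen : IsOpen E := isOpen_adsTilde.inter (isOpen_invisible hL)
  have hpres : Preserves Γ E :=
    (preserves_adsTilde hΓ).inter (preserves_invisible hL.subset hΓ hinv)
  have hconv : ∀ p ∈ E, ∀ r ∈ E, ∀ q ∈ adsTilde, Causal p q → Causal q r → q ∈ E :=
    fun p hp r hr q hq h1 h2 => ⟨hq, mem_invisible_of_causal hp.2 hr.2 h1 h2⟩
  have hfut : ∀ x y : E, Quotient.mk (orbitSetoid Γ E) y ∈ future Γ E (Quotient.mk _ x) ↔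
      ∃ γ ∈ Γ, Chron x.1 (γ y.1) := fun x y =>
    ⟨exists_chron_of_mem_future hΓ hsub hpres, fun ⟨_, hγ, h⟩ =>
      mem_future_of_chron hsub hopen hconv hpres hγ h⟩
  have hpast : ∀ x y : E, Quotient.mk (orbitSetoid Γ E) x ∈ past Γ E (Quotient.mk _ y) ↔
      ∃ γ ∈ Γ, Chron x.1 (γ y.1) := hfut
  refine le_antisymm ?_ ?_
  · intro V hV
    refine (@isOpen_iff_forall_mem_open _ (alexandrovTopology Γ E) V).mpr fun v hv => ?_
    obtain ⟨p, rfl⟩ := Quotient.exists_rep v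
    have hpre : IsOpen (Quotient.mk (orbitSetoid Γ E) ⁻¹' V) := hV.preimage continuous_quotient_mk'
    have hW := hopen.isOpenMap_subtype_val _ hpre
    obtain ⟨ε, hε, hball⟩ := Metric.isOpen_iff.mp hW p.1 ⟨p, hv, rfl⟩
    have hballE : ∀ x ∈ Metric.ball p.1 ε, ∃ h : x ∈ E, Quotient.mk (orbitSetoid Γ E) ⟨x, h⟩ ∈ V := by
      intro x hx
      obtain ⟨⟨x', hx'⟩, hxV, rfl⟩ := hball hx
      exact ⟨hx', hxV⟩
    -- vertical diamonds of height `2 δ n` around `p`, which stay in the ball of radius `ε`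
    let δ : ℕ → ℝ := fun n => ε / 3 * (1 / ((n : ℝ) + 1))
    have hδ0 : ∀ n, 0 < δ n := fun n => mul_pos (by positivity) Nat.one_div_pos_of_nat
    have hδ : ∀ n, δ n ≤ ε / 3 := fun n => by
      refine mul_le_of_le_one_right (by positivity) ?_
      rw [div_le_one (by positivity)]
      linarith [(Nat.cast_nonneg n : (0 : ℝ) ≤ n)]
    have hδlim : Tendsto δ atTop (𝓝 0) := by
      have h1 := (tendsto_one_div_add_atTop_nhds_zero_nat (𝕜 := ℝ)).const_mul (ε / 3)
      rwa [mul_zero] at h1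
    let a : ℕ → Cyl := fun n => (p.1.1, p.1.2 - δ n)
    let b : ℕ → Cyl := fun n => (p.1.1, p.1.2 + δ n)
    have hab : ∀ n, Chron (a n) p.1 ∧ Chron p.1 (b n) := by
      intro n
      have := hδ0 n
      constructor <;> simp [Chron, a, b, sphDist_self, this]
    have hdist : ∀ n x, Causal (a n) x → Causal x (b n) → x ∈ Metric.ball p.1 ε := by
      intro n x h1 h2
      have e1 : sphDist p.1.1 x.1 ≤ x.2 - (p.1.2 - δ n) := h1
      have e2 : sphDist x.1 p.1.1 ≤ p.1.2 + δ n - x.2 := h2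
      have e3 := sphDist_nonneg x.1 p.1.1
      rw [sphDist_comm] at e1
      have := hδ n
      have e4 := dist_le_sphDist x.1 p.1.1
      rw [Metric.mem_ball, Prod.dist_eq, max_lt_iff, Real.dist_eq, abs_lt]
      refine ⟨by linarith, by linarith, by linarith⟩
    have haE : ∀ n, a n ∈ E := fun n =>
      (hballE _ (hdist n (a n) (by simp [Causal, sphDist_self])
        ((hab n).1.trans (hab n).2).causal)).1
    have hbE : ∀ n, b n ∈ E := fun n =>
      (hballE _ (hdist n (b n) ((hab n).1.trans (hab n).2).causal
        (by simp [Causal, sphDist_self]))).1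
    by_contra hnot
    have hex : ∀ n, ∃ x ∈ E, x ∉ Metric.ball p.1 ε ∧ Causal (a n) x ∧
        ∃ γ ∈ Γ, Causal x (γ (b n)) := by
      intro n
      by_contra hall
      apply hnot
      refine ⟨future Γ E (Quotient.mk _ ⟨a n, haE n⟩) ∩ past Γ E (Quotient.mk _ ⟨b n, hbE n⟩),
        ?_, ?_, ?_⟩
      · intro u hu
        obtain ⟨c, rfl⟩ := Quotient.exists_rep u
        obtain ⟨γ, hγ, h1⟩ := (hfut _ _).mp hu.1
        obtain ⟨η, hη, h2⟩ := (hpast _ _).mp hu.2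
        have hc : γ c.1 ∈ E := hpres.mem hγ c.2
        have h3 := chron_of_mem hΓ hγ (hsub c.2) (hsub (hpres.mem hη (hbE n))) h2
        have h4 : γ c.1 ∈ Metric.ball p.1 ε := by
          by_contra hcball
          exact hall ⟨γ c.1, hc, hcball, h1.causal, γ * η, mul_mem hγ hη, h3.causal⟩
        obtain ⟨h5, h6⟩ := hballE _ h4
        have h7 : Quotient.mk (orbitSetoid Γ E) c = Quotient.mk _ ⟨γ c.1, h5⟩ :=
          (mk_eq_mk_iff _ _).mpr ⟨γ, hγ, rfl⟩
        rw [h7]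
        exact h6
      · refine TopologicalSpace.isOpen_generateFrom_of_mem ⟨_, _, ?_, rfl⟩
        exact (hfut _ _).mpr ⟨1, one_mem _, (hab n).1.trans (hab n).2⟩
      · exact ⟨(hfut _ _).mpr ⟨1, one_mem _, (hab n).1⟩, (hpast _ _).mpr ⟨1, one_mem _, (hab n).2⟩⟩
    choose x hxE hxball hax γ hγ hxb using hex
    have halim : Tendsto a atTop (𝓝 p.1) := by
      refine Tendsto.prodMk_nhds tendsto_const_nhds ?_
      simpa using hδlim.const_sub p.1.2
    have hblim : Tendsto b atTop (𝓝 p.1) := by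
      refine Tendsto.prodMk_nhds tendsto_const_nhds ?_
      simpa using hδlim.const_add p.1.2
    obtain ⟨n, hn⟩ := eq_one_of_causal hL hΓ hdisc htf hinv p.2.1 p.2.2 hγ (fun n => (haE n).2)
      (fun n => (hbE n).2) halim hblim fun n => (hax n).trans (hxb n)
    have := hxb n
    rw [hn] at this
    exact hxball n (hdist n (x n) (hax n) this)
  · refine le_generateFrom ?_
    rintro _ ⟨u, v, -, rfl⟩
    obtain ⟨x, rfl⟩ := Quotient.exists_rep u
    obtain ⟨y, rfl⟩ := Quotient.exists_rep v
    refine isOpen_coinduced.mpr ?_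
    have : Quotient.mk (orbitSetoid Γ E) ⁻¹' (future Γ E (Quotient.mk _ x) ∩
        past Γ E (Quotient.mk _ y)) =
        {z : E | ∃ γ ∈ Γ, Chron x.1 (γ z.1)} ∩ {z : E | ∃ γ ∈ Γ, Chron z.1 (γ y.1)} := by
      ext z
      exact and_congr (hfut x z) (hpast z y)
    exact this ▸ (isOpen_preimage_future Γ x.1).inter (isOpen_preimage_past Γ y.1)

end

end AdSCausal

end

theorem theorem9p1 (L : Set AdSCausal.Cyl) (hL : L ⊆ AdSCausal.einHat) (hclosed : IsClosed L)
    (hach : AdSCausal.IsAchronal L) (hgen : AdSCausal.IsGeneric L)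
    (hne : AdSCausal.IsNonelementary L)
    (Γ : Subgroup (AdSCausal.Cyl ≃ₜ AdSCausal.Cyl)) (hΓ : Γ ≤ AdSCausal.SO22Hat)
    (hdisc : AdSCausal.IsDiscreteGroup Γ) (htf : AdSCausal.IsTorsionFreeGroup Γ)
    (hinv : AdSCausal.Preserves Γ L) :
    (AdSCausal.Preserves Γ (AdSCausal.invisibleEin L) ∧
      AdSCausal.ActsFreely Γ (AdSCausal.invisibleEin L) ∧
      AdSCausal.ActsProperlyDiscontinuously Γ (AdSCausal.invisibleEin L)) ∧
    (AdSCausal.Preserves Γ (AdSCausal.invisibleAdS L) ∧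
      AdSCausal.ActsFreely Γ (AdSCausal.invisibleAdS L) ∧
      AdSCausal.ActsProperlyDiscontinuously Γ (AdSCausal.invisibleAdS L)) ∧
    AdSCausal.IsStronglyCausalQuotient Γ (AdSCausal.invisibleAdS L) := by
  have hL' := AdSCausal.isLimitSet_of_isAchronal hL hclosed hach hne
  rw [AdSCausal.invisibleEin_eq hL', AdSCausal.invisibleAdS_eq hL']
  have hpres := AdSCausal.preserves_invisible hL hΓ hinv
  have hein := AdSCausal.properlyDiscontinuous hL' hΓ hdisc hinv
    (Set.inter_subset_right (s := AdSCausal.einHat))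
  have hads := AdSCausal.properlyDiscontinuous hL' hΓ hdisc hinv
    (Set.inter_subset_right (s := AdSCausal.adsTilde))
  exact ⟨⟨(AdSCausal.preserves_einHat hΓ).inter hpres, AdSCausal.actsFreely htf hein, hein⟩,
    ⟨(AdSCausal.preserves_adsTilde hΓ).inter hpres, AdSCausal.actsFreely htf hads, hads⟩,
    AdSCausal.isStronglyCausal hL' hΓ hdisc htf hinv⟩
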